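/- For a family $\mathcal{A}$ of Lebesgue measurable subsets of $\mathbb{R}^d$ of finite Lebesgue measure, we say that an element of $\mathcal{A}$ can be reconstructed using $n$ test sets if there exist measurable sets $T_1,\ldots,T_n\subset\mathbb{R}^d$ such that whenever $A,B\in\mathcal{A}$ and $\lambda^d(A\cap T_i)=\lambda^d(B\cap T_i)$ for every $i=1,\ldots,n$, then $A=B$ (here $\lambda^d$ denotes Lebesgue measure on $\mathbb{R}^d$). Let $d\ge 2$ and let $E\subset\mathbb{R}^d$ be a bounded convex set with nonempty interior. Then an element of the family $\{rE+x : r\ge 1,\ x\in\mathbb{R}^d\}$ can be reconstructed using $d+1$ test sets. -/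

import Mathlib

open MeasureTheory

/-- Let `𝒜` be a family of subsets of `ℝᵈ`. An element of `𝒜` *can be reconstructed using `n` test
sets* if all members of `𝒜` are Lebesgue measurable of finite measure and there are measurable sets
`T₁, …, Tₙ` such that two members `A`, `B` of `𝒜` with `λᵈ(A ∩ Tᵢ) = λᵈ(B ∩ Tᵢ)` for every `i` are
equal as sets.

Lebesgue measurable means `NullMeasurableSet` with respect to `volume`. The test sets are
asked to be Borel, which is no restriction: every Lebesgue measurable set agrees with a Borel set up
to a null set. -/
def CanBeReconstructed {d : ℕ} (𝒜 : Set (Set (EuclideanSpace ℝ (Fin d)))) (n : ℕ) : Prop :=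
  (∀ A ∈ 𝒜, NullMeasurableSet A volume ∧ volume A < ⊤) ∧
  ∃ T : Fin n → Set (EuclideanSpace ℝ (Fin d)), (∀ i, MeasurableSet (T i)) ∧
    ∀ A ∈ 𝒜, ∀ B ∈ 𝒜, (∀ i, volume (A ∩ T i) = volume (B ∩ T i)) → A = B

/-- The set `r E + x`. -/
def magnifiedCopy {d : ℕ} (E : Set (EuclideanSpace ℝ (Fin d))) (r : ℝ)
    (x : EuclideanSpace ℝ (Fin d)) : Set (EuclideanSpace ℝ (Fin d)) :=
  (fun y => r • y + x) '' E

/-- The family of all magnified copies `r E + x` with `r ≥ 1` and `x ∈ ℝᵈ`. -/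
def magnifiedCopies {d : ℕ} (E : Set (EuclideanSpace ℝ (Fin d))) :
    Set (Set (EuclideanSpace ℝ (Fin d))) :=
  {A | ∃ (r : ℝ) (x : EuclideanSpace ℝ (Fin d)), 1 ≤ r ∧ A = magnifiedCopy E r x}

/-! The whole space as a test set reveals `r ^ d * volume E`, hence `r`. Each of the other `d` test
sets is a union of slabs `{z | ⟪a, z⟫ ∈ S}`, with `a` running through a basis. For fixed `r` the
mass of the copy in it is, up to affine changes, `∫ f(u) 1_S(r u + t) du`, where `f` is the section
function of the body along `a` and `t` is `⟪a, x⟫` up to a shift. If this is strictly increasing in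
`t` for every `r ≥ 1`, all coordinates of `x` are determined.

With a bounded increasing profile `g`, `g' = γ > 0`, in place of `1_S`, monotonicity is immediate.
`exists_dither` replaces `g` by an indicator whose interval integrals agree with those of `g` ever
more closely far out. In `exists_measurableSet_strictMono` the derivative in the shift is a pairing
with `-f'`: `g` contributes a positive main term, the far part of the error is small by
`exists_abs_integral_mul_le`, and the part near the origin is small because `f'` has little mass on
short intervals.

This needs `f` absolutely continuous with a square-root modulus, which fails for a general direction
(a cube has flat faces). In a pinched direction the body lies in a paraboloid at each extreme point,
so `f` decays like a square root at both ends; homotheties towards those points then control its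
increments inside. `exists_isPinched_inner_ne_zero` supplies enough such directions: a longest chord
`pq` for an auxiliary Euclidean norm puts the body inside two balls of that norm, centred at one end
and touching at the other, and letting the norm degenerate towards any given vector shows that
pinched directions span. -/

/-! ### Absolute continuity by domination with square-root singularities. -/

theorem absolutelyContinuousOnInterval_of_abs_sub_le {f T : ℝ → ℝ} {M a b : ℝ}
    (hT : AbsolutelyContinuousOnInterval T a b)
    (hf : ∀ u v, |f v - f u| ≤ M * |T v - T u|) :
    AbsolutelyContinuousOnInterval f a b := by
  unfold AbsolutelyContinuousOnInterval at hT ⊢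
  have h2 := hT.const_mul M
  rw [mul_zero] at h2
  refine squeeze_zero (fun E => Finset.sum_nonneg fun _ _ => dist_nonneg) (fun E => ?_) h2
  rw [Finset.mul_sum]
  refine Finset.sum_le_sum fun i _ => ?_
  rw [Real.dist_eq, Real.dist_eq]
  exact hf _ _

/-- A function comparable to the distribution function of the arcsine-type law on `[-1, 1]`. -/
noncomputable def edgeProfile (u : ℝ) : ℝ := √(1 + u) - √(1 - u)

theorem edgeProfile_monotone : Monotone edgeProfile := fun u v h => by
  unfold edgeProfile
  have h1 := Real.sqrt_le_sqrt (show 1 + u ≤ 1 + v by linarith)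
  have h2 := Real.sqrt_le_sqrt (show 1 - v ≤ 1 - u by linarith)
  linarith

theorem sqrt_sub_sqrt_le_sqrt_sub {x y : ℝ} (h : x ≤ y) : √y - √x ≤ √(y - x) := by
  rcases le_total x 0 with hx | hx
  · rw [Real.sqrt_eq_zero_of_nonpos hx, sub_zero]
    exact Real.sqrt_le_sqrt (by linarith)
  · have h1 : √y ≤ √x + √(y - x) := by
      rw [Real.sqrt_le_left (by positivity)]
      have := Real.sq_sqrt hx
      have := Real.sq_sqrt (sub_nonneg.2 h)
      have : 0 ≤ √x * √(y - x) := by positivity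
      nlinarith
    linarith

theorem edgeProfile_sub_le {u v : ℝ} (h : u ≤ v) :
    edgeProfile v - edgeProfile u ≤ 2 * √(v - u) := by
  unfold edgeProfile
  have h1 := sqrt_sub_sqrt_le_sqrt_sub (show 1 + u ≤ 1 + v by linarith)
  have h2 := sqrt_sub_sqrt_le_sqrt_sub (show 1 - v ≤ 1 - u by linarith)
  rw [show 1 + v - (1 + u) = v - u by ring] at h1
  rw [show 1 - u - (1 - v) = v - u by ring] at h2
  linarith

theorem absolutelyContinuousOnInterval_edgeProfile (a b : ℝ) :
    AbsolutelyContinuousOnInterval edgeProfile a b := by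
  have hi : ∀ c d : ℝ, IntervalIntegrable (fun x : ℝ => x ^ (-(1/2) : ℝ)) volume c d := fun c d =>
    intervalIntegral.intervalIntegrable_rpow' (by norm_num)
  -- No sign condition is needed: for `x < 0` both `√x` and `x ^ (-1/2)` are `0`, the latter through
  -- the factor `cos (-π / 2)` in `Real.rpow`.
  have key : ∀ c d : ℝ, ∫ x in c..d, x ^ (-(1/2) : ℝ) = 2 * (√d - √c) := fun c d => by
    rw [integral_rpow (Or.inl (by norm_num)), Real.sqrt_eq_rpow, Real.sqrt_eq_rpow]
    norm_num
    ring
  let θ : ℝ → ℝ := fun s => (1/2) * ((1 + s) ^ (-(1/2) : ℝ) + (1 - s) ^ (-(1/2) : ℝ))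
  have h1 : ∀ c d : ℝ, IntervalIntegrable (fun s : ℝ => (1 + s) ^ (-(1/2) : ℝ)) volume c d := by
    intro c d
    have := (hi (1 + c) (1 + d)).comp_add_left 1
    simpa using this
  have h2 : ∀ c d : ℝ, IntervalIntegrable (fun s : ℝ => (1 - s) ^ (-(1/2) : ℝ)) volume c d := by
    intro c d
    have := (hi (1 - c) (1 - d)).comp_sub_left 1
    simpa using this
  have hθ : ∀ c d, IntervalIntegrable θ volume c d := fun c d => ((h1 c d).add (h2 c d)).const_mul _
  have hint : ∀ x, edgeProfile x = edgeProfile a + ∫ s in a..x, θ s := by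
    intro x
    simp only [θ]
    rw [intervalIntegral.integral_const_mul, intervalIntegral.integral_add (h1 _ _) (h2 _ _),
      intervalIntegral.integral_comp_add_left (fun s => s ^ (-(1/2) : ℝ)),
      intervalIntegral.integral_comp_sub_left (fun s => s ^ (-(1/2) : ℝ)), key, key]
    unfold edgeProfile
    ring
  have hac := (hθ a b).absolutelyContinuousOnInterval_intervalIntegral (c := a) (by simp)
  refine absolutelyContinuousOnInterval_of_abs_sub_le (M := 1) hac fun u v => ?_
  rw [hint u, hint v]
  simp

open Set in
/-- A function supported in `[-1, 1]` whose increments are controlled by those of `edgeProfile` is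
the primitive of an integrable function with Hölder primitive. -/
theorem exists_integrable_deriv {f : ℝ → ℝ} {M : ℝ} (hM : 0 ≤ M)
    (hf : ∀ u v, u ≤ v → |f v - f u| ≤ M * (edgeProfile v - edgeProfile u))
    (hsupp : ∀ u, u ∉ Icc (-1 : ℝ) 1 → f u = 0) :
    ∃ h : ℝ → ℝ, Measurable h ∧ Integrable h ∧ (∀ u, u ∉ Icc (-1 : ℝ) 1 → h u = 0) ∧
      (∀ u v, ∫ x in u..v, h x = f v - f u) ∧
      ∀ a b, a ≤ b → ∫ x in a..b, |h x| ≤ 2 * M * √(b - a) := by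
  have hac : ∀ a b, AbsolutelyContinuousOnInterval f a b := fun a b => by
    refine absolutelyContinuousOnInterval_of_abs_sub_le (M := M)
      (absolutelyContinuousOnInterval_edgeProfile a b) fun u v => ?_
    rcases le_total u v with h | h
    · rw [abs_of_nonneg (sub_nonneg.2 (edgeProfile_monotone h))]
      exact hf u v h
    · rw [abs_sub_comm, abs_sub_comm (edgeProfile v),
        abs_of_nonneg (sub_nonneg.2 (edgeProfile_monotone h))]
      exact hf v u h
  have hzero : ∀ u, u ∉ Icc (-1 : ℝ) 1 → deriv f u = 0 := by
    intro u hu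
    have : f =ᶠ[nhds u] fun _ => (0 : ℝ) := by
      filter_upwards [isClosed_Icc.isOpen_compl.mem_nhds hu] with x hx using hsupp x hx
    rw [this.deriv_eq]
    simp
  -- The functions `M * edgeProfile ± f` are both monotone, so their derivatives are nonnegative.
  have hbound : ∀ᵐ x, |deriv f x| ≤ M * deriv edgeProfile x := by
    have hd : ∀ᵐ x, DifferentiableAt ℝ edgeProfile x :=
      edgeProfile_monotone.ae_differentiableAt
    filter_upwards [hd] with x hx
    have hpos : 0 ≤ deriv edgeProfile x := edgeProfile_monotone.deriv_nonneg
    by_cases hfx : DifferentiableAt ℝ f x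
    · have m1 : Monotone (fun y => M * edgeProfile y - f y) := fun u v huv => by
        have := (abs_le.1 (hf u v huv)).2
        dsimp only
        linarith
      have m2 : Monotone (fun y => M * edgeProfile y + f y) := fun u v huv => by
        have := (abs_le.1 (hf u v huv)).1
        dsimp only
        linarith
      have d1 : HasDerivAt (fun y => M * edgeProfile y - f y) (M * deriv edgeProfile x - deriv f x) x :=
        (hx.hasDerivAt.const_mul M).sub hfx.hasDerivAt
      have d2 : HasDerivAt (fun y => M * edgeProfile y + f y) (M * deriv edgeProfile x + deriv f x) x :=
        (hx.hasDerivAt.const_mul M).add hfx.hasDerivAt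
      have e1 := m1.deriv_nonneg (x := x)
      have e2 := m2.deriv_nonneg (x := x)
      rw [d1.deriv] at e1
      rw [d2.deriv] at e2
      exact abs_le.2 ⟨by linarith, by linarith⟩
    · rw [deriv_zero_of_not_differentiableAt hfx, abs_zero]
      positivity
  refine ⟨deriv f, measurable_deriv f, ?_, hzero, fun u v => (hac u v).integral_deriv_eq_sub, ?_⟩
  · have := (hac (-1) 1).intervalIntegrable_deriv
    rw [intervalIntegrable_iff_integrableOn_Icc_of_le (by norm_num)] at this
    exact (integrableOn_iff_integrable_of_support_subset
      (fun x hx => by_contra fun h => hx (hzero x h))).1 this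
  · intro a b hab
    calc ∫ x in a..b, |deriv f x| ≤ ∫ x in a..b, M * deriv edgeProfile x :=
          intervalIntegral.integral_mono_ae hab (hac a b).intervalIntegrable_deriv.abs
            ((absolutelyContinuousOnInterval_edgeProfile a b).intervalIntegrable_deriv.const_mul M)
            hbound
      _ = M * (edgeProfile b - edgeProfile a) := by
          rw [intervalIntegral.integral_const_mul,
            (absolutelyContinuousOnInterval_edgeProfile a b).integral_deriv_eq_sub]
      _ ≤ M * (2 * √(b - a)) := mul_le_mul_of_nonneg_left (edgeProfile_sub_le hab) hM
      _ = 2 * M * √(b - a) := by ring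

/-! ### Pairing with functions of small primitive. -/

open scoped ContDiff in
/-- Pairing an integrable function with a bounded function all of whose interval integrals are
small. -/
theorem exists_abs_integral_mul_le {h : ℝ → ℝ} (hh : Integrable h) {ε : ℝ} (hε : 0 < ε) :
    ∃ V : ℝ, 0 < V ∧ ∀ ψ : ℝ → ℝ, Measurable ψ → (∀ x, |ψ x| ≤ 1) → ∀ η : ℝ,
      (∀ a b, a ≤ b → |∫ x in a..b, ψ x| ≤ η) → |∫ x, h x * ψ x| ≤ ε + V * η := by
  obtain ⟨q, hqc, hqs, hq⟩ := (memLp_one_iff_integrable.2 hh).exist_eLpNorm_sub_le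
    (by simp) le_rfl hε
  have hqi : Integrable q := hqs.continuous.integrable_of_hasCompactSupport hqc
  have hdc : Continuous (deriv q) := hqs.continuous_deriv (by simp)
  have hdi : Integrable (deriv q) := hdc.integrable_of_hasCompactSupport hqc.deriv
  -- `q` is smooth, compactly supported and `L¹`-close to `h`; integrating by parts moves the
  -- derivative onto `q`. The constant depends on `h` and `ε` only, not on `ψ`. The `+ 1` only
  -- ensures positivity.
  refine ⟨(∫ x, |deriv q x|) + 1, by positivity, fun ψ hψm hψ η hη => ?_⟩
  have hη0 : 0 ≤ η := (abs_nonneg _).trans (hη 0 0 le_rfl)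
  have hmul : ∀ p : ℝ → ℝ, Integrable p → Integrable fun x => p x * ψ x := fun p hp =>
    hp.mul_bdd (c := 1) hψm.aestronglyMeasurable (ae_of_all _ fun x => by simpa using hψ x)
  have hψi : ∀ a b, IntervalIntegrable ψ volume a b := fun a b => by
    rw [intervalIntegrable_iff]
    exact Measure.integrableOn_of_bounded (M := 1) (by simp) hψm.aestronglyMeasurable
      (ae_of_all _ fun x => by simpa using hψ x)
  have h1 : |∫ x, (h x - q x) * ψ x| ≤ ε := by
    have e1 : |∫ x, (h x - q x) * ψ x| ≤ ∫ x, ‖(h - q) x‖ := by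
      refine (abs_integral_le_integral_abs).trans
        (integral_mono (hmul _ (hh.sub hqi)).abs (hh.sub hqi).norm fun x => ?_)
      simp only [abs_mul, Pi.sub_apply, Real.norm_eq_abs]
      exact mul_le_of_le_one_right (abs_nonneg _) (hψ x)
    refine e1.trans ?_
    rw [integral_norm_eq_lintegral_enorm (hh.sub hqi).aestronglyMeasurable]
    rw [eLpNorm_one_eq_lintegral_enorm] at hq
    exact ENNReal.toReal_le_of_le_ofReal hε.le hq
  have h2 : |∫ x, q x * ψ x| ≤ (∫ x, |deriv q x|) * η := by
    obtain ⟨N, hN0, hN⟩ : ∃ N : ℝ, 0 < N ∧ ∀ x, N ≤ |x| → q x = 0 := by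
      obtain ⟨N, hN⟩ := hqc.isCompact.isBounded.subset_closedBall 0
      refine ⟨|N| + 1, by positivity, fun x hx => by_contra fun hne => ?_⟩
      have := hN (subset_tsupport q hne)
      rw [mem_closedBall_zero_iff, Real.norm_eq_abs] at this
      linarith [le_abs_self N]
    have hsub : ∀ p : ℝ → ℝ, ∫ x, q x * p x = ∫ x in (-N)..N, q x * p x := fun p => by
      rw [intervalIntegral.integral_eq_integral_of_support_subset]
      intro x hx
      have : q x ≠ 0 := fun h0 => hx (by simp [h0])
      have hx' : |x| < N := not_le.1 fun hle => this (hN x hle)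
      exact ⟨(abs_lt.1 hx').1, (abs_lt.1 hx').2.le⟩
    set P : ℝ → ℝ := fun x => ∫ s in (-N)..x, ψ s with hP
    have hPac : AbsolutelyContinuousOnInterval P (-N) N :=
      (hψi (-N) N).absolutelyContinuousOnInterval_intervalIntegral (by simp)
    have hqac : AbsolutelyContinuousOnInterval q (-N) N :=
      (hqs.of_le (by simp)).contDiffOn.absolutelyContinuousOnInterval
    have hibp := hqac.integral_mul_deriv_eq_deriv_mul hPac
    rw [hN N (le_abs_self N), hN (-N) (by rw [abs_neg]; exact le_abs_self N)] at hibp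
    have hPd : ∫ x in (-N)..N, q x * deriv P x = ∫ x in (-N)..N, q x * ψ x := by
      refine intervalIntegral.integral_congr_ae ?_
      filter_upwards [(hψi (-N) N).ae_hasDerivAt_integral] with x hx hx2
      rw [(hx (Set.uIoc_subset_uIcc hx2) (-N) (by simp)).deriv]
    rw [hsub, ← hPd, hibp]
    simp only [zero_mul, sub_zero, zero_sub, abs_neg]
    calc |∫ x in (-N)..N, deriv q x * P x| ≤ ∫ x in (-N)..N, |deriv q x| * η := by
          rw [← Real.norm_eq_abs]
          refine intervalIntegral.norm_integral_le_of_norm_le (by linarith) ?_ ?_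
          · refine ae_of_all _ fun x hx => ?_
            rw [Real.norm_eq_abs, abs_mul]
            exact mul_le_mul_of_nonneg_left (hη _ _ hx.1.le) (abs_nonneg _)
          · exact (hdc.abs.mul continuous_const).intervalIntegrable _ _
      _ = (∫ x in (-N)..N, |deriv q x|) * η := intervalIntegral.integral_mul_const _ _
      _ ≤ (∫ x, |deriv q x|) * η := by
          refine mul_le_mul_of_nonneg_right ?_ hη0
          rw [intervalIntegral.integral_of_le (by linarith)]
          exact setIntegral_le_integral hdi.abs (ae_of_all _ fun x => abs_nonneg _)
  have h3 : ∫ x, h x * ψ x = (∫ x, (h x - q x) * ψ x) + ∫ x, q x * ψ x := by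
    rw [← integral_add (hmul (fun x => h x - q x) (hh.sub hqi)) (hmul q hqi)]
    congr 1
    ext x
    ring
  rw [h3]
  refine (abs_add_le _ _).trans ?_
  nlinarith

/-! ### Dithering a density into an indicator. -/

theorem intervalIntegrable_of_abs_le_one {ψ : ℝ → ℝ} (hm : Measurable ψ) (h1 : ∀ x, |ψ x| ≤ 1)
    (a b : ℝ) : IntervalIntegrable ψ volume a b := by
  rw [intervalIntegrable_iff]
  exact Measure.integrableOn_of_bounded (M := 1) (by simp) hm.aestronglyMeasurable
    (ae_of_all _ fun x => by simpa using h1 x)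

theorem abs_indicator_one_sub_le_one {S : Set ℝ} {g : ℝ → ℝ} (h0 : ∀ x, 0 ≤ g x)
    (h1 : ∀ x, g x ≤ 1) (x : ℝ) : |S.indicator (fun _ => (1 : ℝ)) x - g x| ≤ 1 := by
  by_cases hx : x ∈ S
  · rw [Set.indicator_of_mem hx, abs_le]
    constructor <;> linarith [h0 x, h1 x]
  · rw [Set.indicator_of_notMem hx, abs_le]
    constructor <;> linarith [h0 x, h1 x]

open Set in
/-- On a half-line, a `[0, 1]`-valued density is approximated by an indicator function, in the
sense of interval integrals, with a precision prescribed at every location. -/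
theorem exists_dither_nonneg {δ : ℕ → ℝ} (hδ : ∀ n, 0 < δ n) {g : ℝ → ℝ} (hg : Measurable g)
    (h0 : ∀ x, 0 ≤ g x) (h1 : ∀ x, g x ≤ 1) :
    ∃ S : Set ℝ, MeasurableSet S ∧ ∀ (n : ℕ) (a b : ℝ), n ≤ a → a ≤ b →
      |∫ x in a..b, (S.indicator (fun _ => (1 : ℝ)) x - g x)| ≤ δ n := by
  -- `d n` will be the length of a cell starting in `[n, n + 1)`. Such a cell may reach past `n +
  -- 1`, hence the range `i ≤ n + 1`.
  obtain ⟨d, hd0, hd1, hdδ, hanti⟩ : ∃ d : ℕ → ℝ, (∀ n, 0 < d n) ∧ (∀ n, d n ≤ 1) ∧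
      (∀ n i, i ≤ n + 1 → d n ≤ δ i / 2) ∧ Antitone d := by
    have hp : ∀ i, 0 < min (δ i) 1 := fun i => lt_min (hδ i) one_pos
    have hle : ∀ s : Finset ℕ, ∏ j ∈ s, min (δ j) 1 ≤ 1 := fun s =>
      Finset.prod_le_one (fun i _ => (hp i).le) fun i _ => min_le_right _ _
    have hsub : ∀ s t : Finset ℕ, s ⊆ t → ∏ j ∈ t, min (δ j) 1 ≤ ∏ j ∈ s, min (δ j) 1 :=
      fun s t h => by
        rw [← Finset.prod_sdiff h]
        exact mul_le_of_le_one_left (Finset.prod_nonneg fun i _ => (hp i).le) (hle _)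
    refine ⟨fun n => (∏ j ∈ Finset.range (n + 2), min (δ j) 1) / 2, fun n => ?_, fun n => ?_,
      fun n i hi => ?_, fun m n hmn => ?_⟩
    · have : 0 < ∏ j ∈ Finset.range (n + 2), min (δ j) 1 := Finset.prod_pos fun i _ => hp i
      positivity
    · have := hle (Finset.range (n + 2))
      dsimp only
      linarith
    · have := hsub {i} (Finset.range (n + 2)) (by simpa using by omega)
      rw [Finset.prod_singleton] at this
      have := min_le_left (δ i) 1
      dsimp only
      linarith
    · have := hsub (Finset.range (m + 2)) (Finset.range (n + 2))
        (Finset.range_subset_range.2 (by omega))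
      dsimp only
      linarith
  let x : ℕ → ℝ := fun k => Nat.rec 0 (fun _ y => y + d ⌊y⌋₊) k
  have hx0 : x 0 = 0 := rfl
  have hxs : ∀ k, x (k + 1) = x k + d ⌊x k⌋₊ := fun k => rfl
  have hxm : StrictMono x := strictMono_nat_of_lt_succ fun k => by
    rw [hxs]
    linarith [hd0 ⌊x k⌋₊]
  have hxunb : ∀ s, ∃ k, s < x k := by
    intro s
    by_contra hcon
    simp only [not_exists, not_lt] at hcon
    have hlin : ∀ k : ℕ, k * d ⌊s⌋₊ ≤ x k := by
      intro k
      induction k with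
      | zero => simp [hx0]
      | succ k ih =>
        rw [hxs]
        have := hanti (Nat.floor_mono (hcon k))
        push_cast
        linarith
    obtain ⟨k, hk⟩ := exists_nat_gt (s / d ⌊s⌋₊)
    rw [div_lt_iff₀ (hd0 _)] at hk
    linarith [hlin k, hcon k]
  have hgi : ∀ a b, IntervalIntegrable g volume a b := fun a b =>
    intervalIntegrable_of_abs_le_one hg (fun x => abs_le.2 ⟨by linarith [h0 x], h1 x⟩) a b
  let m : ℕ → ℝ := fun k => ∫ s in (x k)..(x (k + 1)), g s
  have hm0 : ∀ k, 0 ≤ m k := fun k =>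
    intervalIntegral.integral_nonneg (hxm.monotone k.le_succ) fun s _ => h0 s
  have hm1 : ∀ k, x k + m k ≤ x (k + 1) := fun k => by
    have : m k ≤ ∫ s in (x k)..(x (k + 1)), (1 : ℝ) :=
      intervalIntegral.integral_mono_on (hxm.monotone k.le_succ) (hgi _ _) (by simp) fun s _ => h1 s
    rw [intervalIntegral.integral_const, smul_eq_mul, mul_one] at this
    linarith
  -- Each cell is filled from the left with exactly the mass of `g` on it, so the error integrates
  -- to zero over full cells and only one partial cell ever counts.
  let S : Set ℝ := ⋃ k, Ioc (x k) (x k + m k)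
  have hS : MeasurableSet S := MeasurableSet.iUnion fun k => measurableSet_Ioc
  have hcell : ∀ k, Ioc (x k) (x (k + 1)) ∩ S = Ioc (x k) (x k + m k) := by
    intro k
    ext s
    simp only [S, mem_inter_iff, mem_iUnion, mem_Ioc]
    constructor
    · rintro ⟨⟨h1, h2⟩, j, h3, h4⟩
      have h5 : j < k + 1 := hxm.lt_iff_lt.1 (h3.trans_le h2)
      have h6 : k < j + 1 := hxm.lt_iff_lt.1 (h1.trans_le (h4.trans (hm1 j)))
      obtain rfl : j = k := by omega
      exact ⟨h1, h4⟩
    · rintro ⟨h1, h2⟩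
      exact ⟨⟨h1, h2.trans (hm1 k)⟩, k, h1, h2⟩
  set σ : ℝ → ℝ := fun x => S.indicator (fun _ => (1 : ℝ)) x - g x with hσ
  have hσm : Measurable σ := (measurable_const.indicator hS).sub hg
  have hσ1 : ∀ x, |σ x| ≤ 1 := abs_indicator_one_sub_le_one h0 h1
  have hσi := intervalIntegrable_of_abs_le_one hσm hσ1
  have hzero : ∀ k, ∫ s in (x k)..(x (k + 1)), σ s = 0 := by
    intro k
    have hSi : IntervalIntegrable (S.indicator fun _ => (1 : ℝ)) volume (x k) (x (k + 1)) := by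
      have := (hσi (x k) (x (k + 1))).add (hgi _ _)
      simpa [hσ] using this
    rw [hσ, intervalIntegral.integral_sub hSi (hgi _ _),
      intervalIntegral.integral_of_le (hxm.monotone k.le_succ), setIntegral_indicator hS, hcell,
      setIntegral_const, measureReal_def, Real.volume_Ioc, add_sub_cancel_left,
      ENNReal.toReal_ofReal (hm0 k)]
    simp [m]
  have hnode : ∀ k, ∫ s in (0 : ℝ)..(x k), σ s = 0 := by
    intro k
    induction k with
    | zero => simp [hx0]
    | succ k ih =>
      rw [← intervalIntegral.integral_add_adjacent_intervals (hσi 0 (x k)) (hσi _ _), ih, hzero,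
        add_zero]
  have hprim : ∀ (n : ℕ) (s : ℝ), n ≤ s → |∫ y in (0 : ℝ)..s, σ y| ≤ δ n / 2 := by
    intro n s hns
    have hs0 : 0 ≤ s := n.cast_nonneg.trans hns
    have hex := hxunb s
    obtain ⟨k, hk1, hk2⟩ : ∃ k, x k ≤ s ∧ s < x (k + 1) := by
      classical
      refine ⟨Nat.find hex - 1, ?_, ?_⟩
      · have hpos : Nat.find hex ≠ 0 := fun h => by
          have := Nat.find_spec hex
          rw [h, hx0] at this
          linarith
        exact not_lt.1 (Nat.find_min hex (by omega))
      · have hpos : Nat.find hex ≠ 0 := fun h => by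
          have := Nat.find_spec hex
          rw [h, hx0] at this
          linarith
        rw [Nat.sub_add_cancel (by omega)]
        exact Nat.find_spec hex
    rw [← intervalIntegral.integral_add_adjacent_intervals (hσi 0 (x k)) (hσi _ _), hnode, zero_add]
    have hlen : |∫ y in (x k)..s, σ y| ≤ 1 * |s - x k| := by
      rw [← Real.norm_eq_abs]
      exact intervalIntegral.norm_integral_le_of_norm_le_const fun y _ => hσ1 y
    rw [one_mul, abs_of_nonneg (sub_nonneg.2 hk1)] at hlen
    have hfl : n ≤ ⌊x k⌋₊ + 1 := by
      have := Nat.lt_floor_add_one (x k)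
      have h2 := hd1 ⌊x k⌋₊
      rw [hxs] at hk2
      have h3 : (n : ℝ) < (⌊x k⌋₊ + 2 : ℕ) := by
        push_cast
        linarith
      have := Nat.cast_lt.1 h3
      omega
    have := hdδ _ _ hfl
    rw [hxs] at hk2
    linarith
  refine ⟨S, hS, fun n a b hna hab => ?_⟩
  have h2 := intervalIntegral.integral_add_adjacent_intervals (hσi 0 a) (hσi a b)
  have ha := abs_le.1 (hprim n a hna)
  have hb := abs_le.1 (hprim n b (hna.trans hab))
  rw [abs_le]
  constructor <;> linarith

open Set in
/-- On the line, a `[0, 1]`-valued density is approximated by an indicator function, in the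
sense of interval integrals, with a precision prescribed at every location. -/
theorem exists_dither {δ : ℕ → ℝ} (hδ : ∀ n, 0 < δ n) {g : ℝ → ℝ} (hg : Measurable g)
    (h0 : ∀ x, 0 ≤ g x) (h1 : ∀ x, g x ≤ 1) :
    ∃ S : Set ℝ, MeasurableSet S ∧ ∀ (n : ℕ) (a b : ℝ), n ≤ a ∨ b ≤ -n → a ≤ b →
      |∫ x in a..b, (S.indicator (fun _ => (1 : ℝ)) x - g x)| ≤ δ n := by
  obtain ⟨S, hS, hSa⟩ := exists_dither_nonneg hδ hg h0 h1
  obtain ⟨S', hS', hSa'⟩ := exists_dither_nonneg hδ (hg.comp measurable_neg)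
    (fun x => h0 (-x)) (fun x => h1 (-x))
  refine ⟨(S ∩ Ioi 0) ∪ (Neg.neg ⁻¹' S' ∩ Iio 0), (hS.inter measurableSet_Ioi).union
    ((measurable_neg hS').inter measurableSet_Iio), fun n a b hn hab => ?_⟩
  rcases hn with hn | hn
  · convert hSa n a b hn hab using 2
    refine intervalIntegral.integral_congr_uIoo fun x hx => ?_
    rw [uIoo_of_le hab] at hx
    have hx0 : 0 < x := (n.cast_nonneg.trans hn).trans_lt hx.1
    have : x ∈ (S ∩ Ioi 0) ∪ (Neg.neg ⁻¹' S' ∩ Iio 0) ↔ x ∈ S := by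
      simp [-neg_preimage, hx0, hx0.le]
    by_cases hm : x ∈ S
    · simp only [indicator_of_mem (this.2 hm), indicator_of_mem hm]
    · simp only [indicator_of_notMem (mt this.1 hm), indicator_of_notMem hm]
  · have hab' : -b ≤ -a := neg_le_neg hab
    convert hSa' n (-b) (-a) (by linarith) hab' using 2
    rw [← intervalIntegral.integral_comp_neg]
    refine intervalIntegral.integral_congr_uIoo fun x hx => ?_
    rw [uIoo_of_le hab] at hx
    have hx0 : x < 0 := hx.2.trans_le (hn.trans (by simp))
    have : x ∈ (S ∩ Ioi 0) ∪ (Neg.neg ⁻¹' S' ∩ Iio 0) ↔ -x ∈ S' := by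
      simp [-neg_preimage, hx0, hx0.le]
    by_cases hm : -x ∈ S'
    · simp only [indicator_of_mem (this.2 hm), indicator_of_mem hm, Function.comp_apply, neg_neg]
    · simp only [indicator_of_notMem (mt this.1 hm), indicator_of_notMem hm, Function.comp_apply,
        neg_neg]

/-! ### Truncation, rescaling and translation of windows. -/

open Set in
theorem abs_integral_indicator_Ioi_le {σ : ℝ → ℝ} {n η : ℝ} (hη : 0 ≤ η)
    (hσ : ∀ a b, n ≤ a → a ≤ b → |∫ x in a..b, σ x| ≤ η) {a b : ℝ} (hab : a ≤ b) :
    |∫ x in a..b, (Ioi n).indicator σ x| ≤ η := by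
  rw [intervalIntegral.integral_of_le hab, setIntegral_indicator measurableSet_Ioi, Ioc_inter_Ioi]
  rcases le_total (a ⊔ n) b with h | h
  · rw [← intervalIntegral.integral_of_le h]
    exact hσ _ _ le_sup_right h
  · rw [Ioc_eq_empty (not_lt.2 h)]
    simpa using hη

open Set in
theorem abs_integral_indicator_Iic_le {σ : ℝ → ℝ} {n η : ℝ} (hη : 0 ≤ η)
    (hσ : ∀ a b, b ≤ n → a ≤ b → |∫ x in a..b, σ x| ≤ η) {a b : ℝ} (hab : a ≤ b) :
    |∫ x in a..b, (Iic n).indicator σ x| ≤ η := by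
  rw [intervalIntegral.integral_of_le hab, setIntegral_indicator measurableSet_Iic, Ioc_inter_Iic]
  rcases le_total a (b ⊓ n) with h | h
  · rw [← intervalIntegral.integral_of_le h]
    exact hσ _ _ inf_le_right h
  · rw [Ioc_eq_empty (not_lt.2 h)]
    simpa using hη

theorem abs_integral_comp_mul_add_le {φ : ℝ → ℝ} {r η τ : ℝ} (hr : 1 ≤ r)
    (hφ : ∀ a b, a ≤ b → |∫ x in a..b, φ x| ≤ η) {a b : ℝ} (hab : a ≤ b) :
    |∫ x in a..b, φ (r * x + τ)| ≤ η := by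
  rw [intervalIntegral.integral_comp_mul_add _ (by positivity), smul_eq_mul, abs_mul,
    abs_of_pos (by positivity)]
  have h1 := hφ (r * a + τ) (r * b + τ) (by gcongr)
  exact (mul_le_of_le_one_left (abs_nonneg _) (inv_le_one_of_one_le₀ hr)).trans h1

/-- Translating a window across a bounded function: the change of the weighted integral is
expressed by the derivative of the weight. -/
theorem integral_mul_comp_sub_eq {f h χ : ℝ → ℝ} (hfi : Integrable f) (hhm : Measurable h)
    (hhi : Integrable h) (hfh : ∀ u v, ∫ x in u..v, h x = f v - f u) (hχm : Measurable χ)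
    (hχ : ∀ x, |χ x| ≤ 1) (r t t' : ℝ) (htt : t ≤ t') :
    IntervalIntegrable (fun y => ∫ u, h u * χ (r * (u + y))) volume t t' ∧
    (∫ u, f u * χ (r * (u + t'))) - ∫ u, f u * χ (r * (u + t)) =
      - ∫ y in t..t', ∫ u, h u * χ (r * (u + y)) := by
  -- With the shift moved onto the weight, the increment of `f` is an integral of `h` and Fubini
  -- applies, although `χ` has no regularity.
  have hshift : ∀ p : ℝ → ℝ, ∀ y, ∫ u, p u * χ (r * (u + y)) = ∫ u, p (u - y) * χ (r * u) := by
    intro p y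
    rw [← integral_sub_right_eq_self (fun u => p u * χ (r * (u + y))) y]
    simp
  have hmul : ∀ p : ℝ → ℝ, Integrable p → Integrable fun x => p x * χ (r * x) := fun p hp =>
    hp.mul_bdd (c := 1) (hχm.comp (measurable_const_mul r)).aestronglyMeasurable
      (ae_of_all _ fun x => by simpa using hχ _)
  have hprodm : Measurable fun z : ℝ × ℝ => h (z.2 - z.1) * χ (r * z.2) :=
    (hhm.comp (measurable_snd.sub measurable_fst)).mul
      (hχm.comp (measurable_snd.const_mul r))
  have hprod : Integrable (fun z : ℝ × ℝ => h (z.2 - z.1) * χ (r * z.2))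
      ((volume.restrict (Set.Ioc t t')).prod volume) := by
    rw [integrable_prod_iff hprodm.aestronglyMeasurable]
    refine ⟨ae_of_all _ fun s => hmul (fun u => h (u - s)) (hhi.comp_sub_right s), ?_⟩
    refine Measure.integrableOn_of_bounded (M := ∫ x, |h x|) (by simp)
      (hprodm.norm.stronglyMeasurable.integral_prod_right).aestronglyMeasurable
      (ae_of_all _ fun s => ?_)
    rw [Real.norm_of_nonneg (integral_nonneg fun _ => norm_nonneg _)]
    have : ∫ u, |h (u - s)| = ∫ u, |h u| := integral_sub_right_eq_self (fun u => |h u|) s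
    rw [← this]
    refine integral_mono (hmul (fun u => h (u - s)) (hhi.comp_sub_right s)).norm
      (hhi.comp_sub_right s).abs fun u => ?_
    simp only [Real.norm_eq_abs, abs_mul]
    exact mul_le_of_le_one_right (abs_nonneg _) (hχ _)
  simp only [hshift]
  refine ⟨?_, ?_⟩
  · rw [intervalIntegrable_iff_integrableOn_Ioc_of_le htt]
    exact hprod.integral_prod_left
  · rw [← integral_sub (hmul _ (hfi.comp_sub_right t')) (hmul _ (hfi.comp_sub_right t)),
      intervalIntegral.integral_of_le htt, integral_integral_swap hprod, ← integral_neg]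
    refine integral_congr_ae (ae_of_all _ fun u => ?_)
    simp only
    rw [integral_mul_const, ← intervalIntegral.integral_of_le htt,
      intervalIntegral.integral_comp_sub_left, hfh]
    ring

theorem hasDerivAt_integral_Iic {γ : ℝ → ℝ} (hγ : Continuous γ) (hγi : Integrable γ) (s : ℝ) :
    HasDerivAt (fun s => ∫ x in Set.Iic s, γ x) (γ s) s := by
  have h1 : (fun s => ∫ x in Set.Iic s, γ x) =
      fun s => (∫ x in Set.Iic (0 : ℝ), γ x) + ∫ x in (0 : ℝ)..s, γ x := by
    ext s
    rw [← intervalIntegral.integral_Iic_sub_Iic hγi.integrableOn hγi.integrableOn]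
    ring
  rw [h1]
  exact (intervalIntegral.integral_hasDerivAt_right (hγ.intervalIntegrable _ _)
    hγ.stronglyMeasurable.stronglyMeasurableAtFilter hγ.continuousAt).const_add _

/-- Integration by parts on `[-2, 2]`, where the boundary terms vanish. It gives the main term a
definite sign once `f` and `γ` are nonnegative. -/
theorem integral_mul_comp_eq_neg {f h g γ : ℝ → ℝ} (hhi : Integrable h)
    (hh : ∀ u, u ∉ Set.Icc (-1 : ℝ) 1 → h u = 0) (hf : ∀ u, u ∉ Set.Icc (-1 : ℝ) 1 → f u = 0)
    (hfh : ∀ u v, ∫ x in u..v, h x = f v - f u)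
    (hγ : Continuous γ) (hg : ∀ s, HasDerivAt g (γ s) s) (r τ : ℝ) :
    ∫ u, h u * g (r * u + τ) = - (r * ∫ u, f u * γ (r * u + τ)) := by
  have hout : ∀ u : ℝ, u ∉ Set.Ioc (-2 : ℝ) 2 → u ∉ Set.Icc (-1 : ℝ) 1 := fun u hu h =>
    hu ⟨by linarith [h.1], by linarith [h.2]⟩
  have f2 : f 2 = 0 := hf 2 (by norm_num)
  have f2' : f (-2) = 0 := hf (-2) (by norm_num)
  have hfeq : f = fun v => ∫ x in (-2 : ℝ)..v, h x := by
    ext v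
    rw [hfh, f2', sub_zero]
  have hfac : AbsolutelyContinuousOnInterval f (-2) 2 := by
    rw [hfeq]
    exact hhi.intervalIntegrable.absolutelyContinuousOnInterval_intervalIntegral (by simp)
  have hGd : ∀ u, HasDerivAt (fun u => g (r * u + τ)) (γ (r * u + τ) * r) u := fun u => by
    have h2 : HasDerivAt (fun u => r * u + τ) r u := by
      simpa using ((hasDerivAt_id u).const_mul r).add_const τ
    exact (hg (r * u + τ)).comp u h2
  have hGdd : deriv (fun u => g (r * u + τ)) = fun u => γ (r * u + τ) * r :=
    funext fun u => (hGd u).deriv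
  have hGac : AbsolutelyContinuousOnInterval (fun u => g (r * u + τ)) (-2) 2 := by
    refine (contDiff_one_iff_deriv.2 ⟨fun u => (hGd u).differentiableAt, ?_⟩).contDiffOn.absolutelyContinuousOnInterval
    rw [hGdd]
    fun_prop
  have hibp := hfac.integral_mul_deriv_eq_deriv_mul hGac
  rw [f2, f2', hGdd] at hibp
  have hfd : ∫ x in (-2 : ℝ)..2, deriv f x * g (r * x + τ) =
      ∫ x in (-2 : ℝ)..2, h x * g (r * x + τ) := by
    refine intervalIntegral.integral_congr_ae ?_
    have hloc : IntervalIntegrable h volume (-2) 2 := hhi.intervalIntegrable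
    filter_upwards [hloc.ae_hasDerivAt_integral] with x hx hx2
    rw [hfeq, (hx (Set.uIoc_subset_uIcc hx2) (-2) (by simp)).deriv]
  have e1 : ∫ u, h u * g (r * u + τ) = ∫ x in (-2 : ℝ)..2, h x * g (r * x + τ) := by
    rw [intervalIntegral.integral_eq_integral_of_support_subset]
    exact fun x hx => by_contra fun hc => hx (by simp [hh x (hout x hc)])
  have e2 : r * ∫ u, f u * γ (r * u + τ) = ∫ x in (-2 : ℝ)..2, f x * (γ (r * x + τ) * r) := by
    rw [intervalIntegral.integral_eq_integral_of_support_subset, ← integral_const_mul]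
    · congr 1
      ext u
      ring
    · exact fun x hx => by_contra fun hc => hx (by simp [hf x (hout x hc)])
  rw [e1, ← hfd, e2, hibp]
  ring

/-- Put `R = r + |τ|`. Since `R ≤ 3 r`, both sides have order `R ^ (-1/4)`, and the left one carries
the factor `√κ`. The proof works with `q`, the fourth root of `R`. -/
theorem exists_forall_mul_sqrt_le {m C : ℝ} (hm : 0 < m) (hC : 0 < C) :
    ∃ κ : ℝ, 0 < κ ∧ κ ≤ 1 / 2 ∧ ∀ r τ : ℝ, 1 ≤ r → |τ| < 2 * r →
      C * √(2 * (κ * √(r + |τ|)) / r) ≤ m / 4 * (r * (1 + (r + |τ|)) ^ (-(5 / 4) : ℝ)) := by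
  refine ⟨min (1 / 2) (m ^ 2 / (6 * 48 ^ 2 * C ^ 2)), by positivity, min_le_left _ _,
    fun r τ hr hτ => ?_⟩
  set κ := min (1 / 2) (m ^ 2 / (6 * 48 ^ 2 * C ^ 2)) with hκ
  have hκ0 : 0 < κ := by positivity
  have hκ2 : κ ≤ m ^ 2 / (6 * 48 ^ 2 * C ^ 2) := min_le_right _ _
  have habs := abs_nonneg τ
  set R := r + |τ| with hR
  have hR1 : 1 ≤ R := by linarith
  set q := √√R with hq
  have hq0 : 0 < q := by positivity
  have hq2 : √R = q ^ 2 := (Real.sq_sqrt (Real.sqrt_nonneg R)).symm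
  have hq4 : R = q ^ 4 := by
    rw [show q ^ 4 = (q ^ 2) ^ 2 by ring, ← hq2, Real.sq_sqrt (by linarith)]
  have hr3 : q ^ 4 / 3 ≤ r := by rw [← hq4]; linarith
  have hpow : (1 + R) ^ (5 / 4 : ℝ) ≤ 4 * q ^ 5 := by
    calc (1 + R) ^ (5 / 4 : ℝ) ≤ (2 * q ^ 4) ^ (5 / 4 : ℝ) := by
          apply Real.rpow_le_rpow (by linarith) _ (by norm_num)
          linarith
      _ = 2 ^ (5 / 4 : ℝ) * q ^ 5 := by
          rw [Real.mul_rpow (by norm_num) (by positivity), ← Real.rpow_natCast, ← Real.rpow_natCast,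
            ← Real.rpow_mul hq0.le]
          norm_num
      _ ≤ 2 ^ (2 : ℝ) * q ^ 5 := by
          gcongr <;> norm_num
      _ = 4 * q ^ 5 := by norm_num
  have hR' : m / (48 * q) ≤ m / 4 * (r * (1 + R) ^ (-(5 / 4) : ℝ)) := by
    rw [Real.rpow_neg (by linarith)]
    calc m / (48 * q) = m / 4 * (q ^ 4 / 3 * (4 * q ^ 5)⁻¹) := by
          field_simp
          norm_num
      _ ≤ _ := by gcongr
  refine le_trans ?_ hR'
  have h1 : 2 * (κ * √R) / r ≤ (m / (48 * q) / C) ^ 2 := by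
    rw [hq2]
    calc 2 * (κ * q ^ 2) / r ≤ 2 * (m ^ 2 / (6 * 48 ^ 2 * C ^ 2) * q ^ 2) / (q ^ 4 / 3) := by
          gcongr
      _ = (m / (48 * q) / C) ^ 2 := by
          field_simp
          norm_num
  have h2 : √(2 * (κ * √R) / r) ≤ m / (48 * q) / C := by
    rw [Real.sqrt_le_left (by positivity)]
    exact h1
  rw [le_div_iff₀ hC] at h2
  linarith

/-! ### The detecting set on the line. -/

open Set in
/-- The window `f` slid over a suitable measurable set of the line, at any scale `r ≥ 1`, collects
a strictly increasing amount of mass. -/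
theorem exists_measurableSet_strictMono {f h : ℝ → ℝ} {c C : ℝ} (hc : 0 < c) (hC : 0 < C)
    (hf0 : ∀ u, 0 ≤ f u) (hfc : ∀ u, |u| ≤ 1 / 2 → c ≤ f u)
    (hf : ∀ u, u ∉ Icc (-1 : ℝ) 1 → f u = 0) (hhm : Measurable h) (hhi : Integrable h)
    (hh : ∀ u, u ∉ Icc (-1 : ℝ) 1 → h u = 0) (hfh : ∀ u v, ∫ x in u..v, h x = f v - f u)
    (hhC : ∀ a b, a ≤ b → ∫ x in a..b, |h x| ≤ C * √(b - a)) :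
    ∃ S : Set ℝ, MeasurableSet S ∧ ∀ r : ℝ, 1 ≤ r →
      StrictMono fun t => ∫ u, f u * S.indicator (fun _ => (1 : ℝ)) (r * u + t) := by
  have hfcont : Continuous f := by
    have : f = fun v => ∫ x in (-2 : ℝ)..v, h x := by
      ext v
      rw [hfh, hf (-2) (by norm_num), sub_zero]
    rw [this]
    exact intervalIntegral.continuous_primitive (fun a b => hhi.intervalIntegrable) _
  have hfi : Integrable f := hfcont.integrable_of_hasCompactSupport
    (HasCompactSupport.intro isCompact_Icc hf)
  -- An exponent above `1` makes `γ₀` integrable; `5 / 4` is slow enough for the comparison in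
  -- `exists_forall_mul_sqrt_le`.
  let γ₀ : ℝ → ℝ := fun s => (1 + ‖s‖) ^ (-(5 / 4) : ℝ)
  have hγ₀c : Continuous γ₀ := by
    refine Continuous.rpow_const (by fun_prop) fun s => Or.inl ?_
    positivity
  have hγ₀i : Integrable γ₀ := integrable_one_add_norm (by simp; norm_num)
  have hγ₀pos : ∀ s, 0 < γ₀ s := fun s => by positivity
  have hI : 0 < ∫ s, γ₀ s := by
    rw [integral_pos_iff_support_of_nonneg (fun s => (hγ₀pos s).le) hγ₀i,
      show Function.support γ₀ = univ from eq_univ_of_forall fun s => (hγ₀pos s).ne']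
    simp
  set c₀ := (∫ s, γ₀ s)⁻¹ with hc₀
  have hc₀pos : 0 < c₀ := inv_pos.2 hI
  let γ : ℝ → ℝ := fun s => c₀ * γ₀ s
  have hγc : Continuous γ := hγ₀c.const_mul c₀
  have hγi : Integrable γ := hγ₀i.const_mul c₀
  have hγ0 : ∀ s, 0 ≤ γ s := fun s => (mul_pos hc₀pos (hγ₀pos s)).le
  let g : ℝ → ℝ := fun s => ∫ x in Iic s, γ x
  have hgd : ∀ s, HasDerivAt g (γ s) s := hasDerivAt_integral_Iic hγc hγi
  have hgm : Measurable g :=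
    (continuous_iff_continuousAt.2 fun s => (hgd s).continuousAt).measurable
  have hg0 : ∀ s, 0 ≤ g s := fun s => integral_nonneg fun x => hγ0 x
  have hg1 : ∀ s, g s ≤ 1 := fun s => by
    calc g s ≤ ∫ x, γ x := setIntegral_le_integral hγi (ae_of_all _ hγ0)
      _ = 1 := by
        simp only [γ]
        rw [integral_const_mul, hc₀, inv_mul_cancel₀ hI.ne']
  set m := c * c₀ with hm
  have hm0 : 0 < m := mul_pos hc hc₀pos
  obtain ⟨κ, hκ0, hκ1, hκ⟩ := exists_forall_mul_sqrt_le hm0 hC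
  -- Below, `n = ⌊κ √R⌋₊`, so `R ≤ ((n + 1) / κ) ^ 2` and `4 * ε n` is at most a quarter of the
  -- lower bound for the main term. The `V n` depend on `h` and `ε n` alone and can thus be fixed
  -- before `S`.
  let ε : ℕ → ℝ := fun n => m / 16 * (1 + ((n + 1) / κ) ^ 2) ^ (-(5 / 4) : ℝ)
  have hε : ∀ n, 0 < ε n := fun n => by positivity
  choose V hV0 hV using fun n => exists_abs_integral_mul_le hhi (hε n)
  obtain ⟨S, hS, hSη⟩ := exists_dither (δ := fun n => ε n / V n) (fun n => div_pos (hε n) (hV0 n))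
    hgm hg0 hg1
  refine ⟨S, hS, fun r hr t t' htt => ?_⟩
  have hr0 : 0 < r := by linarith
  set χ : ℝ → ℝ := S.indicator (fun _ => (1 : ℝ)) with hχ
  have hχm : Measurable χ := measurable_const.indicator hS
  have hχ1 : ∀ x, |χ x| ≤ 1 := fun x => by
    by_cases hx : x ∈ S <;> simp [hχ, hx]
  set σ : ℝ → ℝ := fun x => χ x - g x with hσ
  have hσm : Measurable σ := hχm.sub hgm
  have hσ1 : ∀ x, |σ x| ≤ 1 := abs_indicator_one_sub_le_one hg0 hg1
  have hbdd : ∀ p : ℝ → ℝ, Measurable p → (∀ x, |p x| ≤ 1) → Integrable fun x => h x * p x :=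
    fun p hpm hp => hhi.mul_bdd (c := 1) hpm.aestronglyMeasurable
      (ae_of_all _ fun x => by simpa using hp _)
  have hlin : ∀ τ, Measurable fun u : ℝ => r * u + τ := fun τ => by fun_prop
  -- The main term is at least `m r (1 + R) ^ (-5/4)`. The two far errors together and the middle
  -- error each cost at most a quarter of this.
  have hneg : ∀ τ, ∫ u, h u * χ (r * u + τ) < 0 := by
    intro τ
    have hmain : m * (r * (1 + (r + |τ|)) ^ (-(5 / 4) : ℝ)) ≤ r * ∫ u, f u * γ (r * u + τ) := by
      have hint : Integrable fun u => f u * γ (r * u + τ) := by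
        refine (hfcont.mul (hγc.comp (by fun_prop))).integrable_of_hasCompactSupport
          (HasCompactSupport.intro (isCompact_Icc (a := -1) (b := 1)) fun u hu => ?_)
        simp [hf u hu]
      have h1 : ∫ u in Icc (-(1 / 2) : ℝ) (1 / 2), m * (1 + (r + |τ|)) ^ (-(5 / 4) : ℝ) ≤
          ∫ u in Icc (-(1 / 2) : ℝ) (1 / 2), f u * γ (r * u + τ) := by
        refine setIntegral_mono_on continuous_const.integrableOn_Icc hint.integrableOn measurableSet_Icc fun u hu => ?_
        rw [hm, mul_assoc]
        refine mul_le_mul (hfc u (abs_le.2 hu)) ?_ (by positivity) (hf0 u)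
        refine mul_le_mul_of_nonneg_left ?_ hc₀pos.le
        refine Real.rpow_le_rpow_of_nonpos (by positivity) ?_ (by norm_num)
        have h2 : |u| ≤ 1 / 2 := abs_le.2 hu
        have h3 : |r * u + τ| ≤ r * |u| + |τ| := by
          refine (abs_add_le _ _).trans ?_
          rw [abs_mul, abs_of_pos hr0]
        have h4 : r * |u| ≤ r * 1 := by
          gcongr
          linarith
        rw [Real.norm_eq_abs]
        linarith
      have h2 : ∫ u in Icc (-(1 / 2) : ℝ) (1 / 2), f u * γ (r * u + τ) ≤
          ∫ u, f u * γ (r * u + τ) :=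
        setIntegral_le_integral hint (ae_of_all _ fun u => mul_nonneg (hf0 u) (hγ0 _))
      rw [setIntegral_const, measureReal_def, Real.volume_Icc] at h1
      norm_num at h1
      calc _ = r * (m * (1 + (r + |τ|)) ^ (-(5 / 4) : ℝ)) := by ring
        _ ≤ _ := by
          gcongr
          norm_num
          exact h1.trans h2
    set R := r + |τ| with hR
    have hR1 : 1 ≤ R := by linarith [abs_nonneg τ]
    set n := ⌊κ * √R⌋₊ with hn
    have hn1 : (n : ℝ) ≤ κ * √R := Nat.floor_le (by positivity)
    have hn2 : κ * √R < n + 1 := Nat.lt_floor_add_one _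
    have hεn : 4 * ε n ≤ m / 4 * (r * (1 + R) ^ (-(5 / 4) : ℝ)) := by
      have h1 : R ≤ ((n + 1) / κ) ^ 2 := by
        have : √R ≤ (n + 1) / κ := by
          rw [le_div_iff₀ hκ0]
          linarith
        calc R = √R ^ 2 := (Real.sq_sqrt (by linarith)).symm
          _ ≤ _ := by gcongr
      have h2 : (1 + ((n + 1) / κ) ^ 2) ^ (-(5 / 4) : ℝ) ≤ (1 + R) ^ (-(5 / 4) : ℝ) :=
        Real.rpow_le_rpow_of_nonpos (by linarith) (by linarith) (by norm_num)
      have h3 : (1 + R) ^ (-(5 / 4) : ℝ) ≤ r * (1 + R) ^ (-(5 / 4) : ℝ) :=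
        le_mul_of_one_le_left (by positivity) hr
      calc 4 * ε n = m / 4 * (1 + ((n + 1) / κ) ^ 2) ^ (-(5 / 4) : ℝ) := by
            simp only [ε]
            ring
        _ ≤ _ := by
          gcongr
          exact h2.trans h3
    have hfar : ∀ p : ℝ → ℝ, Measurable p → (∀ x, |p x| ≤ 1) →
        (∀ a b, a ≤ b → |∫ x in a..b, p x| ≤ ε n / V n) →
        |∫ u, h u * p (r * u + τ)| ≤ 2 * ε n := by
      intro p hpm hp1 hp
      have := hV n (fun u => p (r * u + τ)) (hpm.comp (hlin τ)) (fun x => hp1 _) (ε n / V n)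
        (fun a b hab => abs_integral_comp_mul_add_le hr hp hab)
      rw [mul_div_cancel₀ _ (hV0 n).ne'] at this
      linarith
    have hη0 : 0 ≤ ε n / V n := (div_pos (hε n) (hV0 n)).le
    have hi1 : ∀ (A : Set ℝ) (x : ℝ), |A.indicator σ x| ≤ 1 := fun A x => by
      by_cases hx : x ∈ A
      · simpa [hx] using hσ1 x
      · simp [hx]
    have hplus := hfar ((Ioi (n : ℝ)).indicator σ) (hσm.indicator measurableSet_Ioi) (hi1 _)
      fun a b hab => abs_integral_indicator_Ioi_le hη0
        (fun a b ha hab => hSη n a b (Or.inl ha) hab) hab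
    have hminus := hfar ((Iic (-n : ℝ)).indicator σ) (hσm.indicator measurableSet_Iic) (hi1 _)
      fun a b hab => abs_integral_indicator_Iic_le hη0
        (fun a b ha hab => hSη n a b (Or.inr ha) hab) hab
    -- Near the origin the dithering gives no useful precision. For `|τ| < 2 r` only an interval of
    -- `u` of length `2 n / r` is involved, and `hhC` bounds the mass of `h` there; for `|τ| ≥ 2 r`
    -- the window misses `[-n, n]`, by `κ ≤ 1 / 2`.
    have hmid : |∫ u, h u * (Ioc (-n : ℝ) n).indicator σ (r * u + τ)| ≤
        m / 4 * (r * (1 + R) ^ (-(5 / 4) : ℝ)) := by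
      rcases lt_or_ge |τ| (2 * r) with hτ | hτ
      · have hab : (-n - τ) / r ≤ (n - τ) / r := by
          gcongr
          linarith [(n.cast_nonneg : (0 : ℝ) ≤ n)]
        calc |∫ u, h u * (Ioc (-n : ℝ) n).indicator σ (r * u + τ)|
            ≤ ∫ u, |h u * (Ioc (-n : ℝ) n).indicator σ (r * u + τ)| := abs_integral_le_integral_abs
          _ ≤ ∫ u, (Ioc ((-n - τ) / r) ((n - τ) / r)).indicator (fun u => |h u|) u := by
              refine integral_mono (hbdd _ ((hσm.indicator measurableSet_Ioc).comp (hlin τ))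
                fun x => hi1 _ _).abs (hhi.abs.indicator measurableSet_Ioc) fun u => ?_
              dsimp only
              by_cases hu : r * u + τ ∈ Ioc (-n : ℝ) n
              · have hu' : u ∈ Ioc ((-n - τ) / r) ((n - τ) / r) := by
                  rw [mem_Ioc, div_lt_iff₀ hr0, le_div_iff₀ hr0]
                  constructor <;> linarith [hu.1, hu.2]
                rw [indicator_of_mem hu', abs_mul]
                exact mul_le_of_le_one_right (abs_nonneg _) (hi1 _ _)
              · rw [indicator_of_notMem hu, mul_zero, abs_zero]
                exact indicator_nonneg (fun _ _ => abs_nonneg _) _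
          _ = ∫ u in ((-n - τ) / r)..((n - τ) / r), |h u| := by
              rw [integral_indicator measurableSet_Ioc, intervalIntegral.integral_of_le hab]
          _ ≤ C * √((n - τ) / r - (-n - τ) / r) := hhC _ _ hab
          _ ≤ C * √(2 * (κ * √R) / r) := by
              rw [show ((n : ℝ) - τ) / r - (-n - τ) / r = 2 * n / r by ring]
              gcongr
          _ ≤ _ := hκ r τ hr hτ
      · have hz : ∀ u, h u * (Ioc (-n : ℝ) n).indicator σ (r * u + τ) = 0 := by
          intro u
          by_cases hu : u ∈ Icc (-1 : ℝ) 1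
          · rw [indicator_of_notMem, mul_zero]
            intro hmem
            have h1 : |r * u| ≤ r := by
              rw [abs_mul, abs_of_pos hr0]
              exact mul_le_of_le_one_right hr0.le (abs_le.2 hu)
            have h2 : |r * u + τ| ≤ n := abs_le.2 ⟨hmem.1.le, hmem.2⟩
            have h3 : |τ| ≤ |r * u + τ| + |r * u| := by
              calc |τ| = |(r * u + τ) - r * u| := by ring_nf
                _ ≤ _ := abs_sub _ _
            have h4 : (n : ℝ) ≤ 1 / 2 * √R := hn1.trans (by gcongr)
            have h5 : |τ| ≤ √R := by linarith
            have h6 : |τ| ^ 2 ≤ R := by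
              rw [← Real.sq_sqrt (show 0 ≤ R by linarith)]
              gcongr
            nlinarith
          · rw [hh u hu, zero_mul]
        simp only [hz, integral_zero, abs_zero]
        positivity
    have hsplit : ∫ u, h u * σ (r * u + τ) =
        (∫ u, h u * (Ioi (n : ℝ)).indicator σ (r * u + τ)) +
        (∫ u, h u * (Iic (-n : ℝ)).indicator σ (r * u + τ)) +
        ∫ u, h u * (Ioc (-n : ℝ) n).indicator σ (r * u + τ) := by
      have i1 := hbdd _ ((hσm.indicator (measurableSet_Ioi (a := (n : ℝ)))).comp (hlin τ))
        fun x => hi1 _ _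
      have i2 := hbdd _ ((hσm.indicator (measurableSet_Iic (a := (-n : ℝ)))).comp (hlin τ))
        fun x => hi1 _ _
      have i3 := hbdd _ ((hσm.indicator (measurableSet_Ioc (a := (-n : ℝ)) (b := n))).comp (hlin τ))
        fun x => hi1 _ _
      simp only [Function.comp_apply] at i1 i2 i3
      have i12 : Integrable fun u => h u * (Ioi (n : ℝ)).indicator σ (r * u + τ) +
          h u * (Iic (-n : ℝ)).indicator σ (r * u + τ) := i1.add i2
      rw [← integral_add i1 i2, ← integral_add i12 i3]
      refine integral_congr_ae (ae_of_all _ fun u => ?_)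
      dsimp only
      rw [← mul_add, ← mul_add]
      congr 1
      have hn0 : (0 : ℝ) ≤ n := n.cast_nonneg
      generalize r * u + τ = x
      rcases le_or_gt x (-n) with h1 | h1
      · rw [indicator_of_notMem (by simpa using by linarith), indicator_of_mem (show x ∈ Iic (-n : ℝ) from h1),
          indicator_of_notMem fun h => by linarith [h.1]]
        ring
      · rcases le_or_gt x n with h2 | h2
        · rw [indicator_of_notMem (by simpa using h2), indicator_of_notMem (by simpa using h1),
            indicator_of_mem (show x ∈ Ioc (-n : ℝ) n from ⟨h1, h2⟩)]
          ring
        · rw [indicator_of_mem (show x ∈ Ioi (n : ℝ) from h2),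
            indicator_of_notMem (by simpa using h1), indicator_of_notMem fun h => by linarith [h.2]]
          ring
    have hg' : Integrable fun u => h u * g (r * u + τ) :=
      hbdd _ (hgm.comp (hlin τ)) fun x => abs_le.2 ⟨by linarith [hg0 (r * x + τ)], hg1 _⟩
    have hχσ : ∫ u, h u * χ (r * u + τ) =
        (∫ u, h u * σ (r * u + τ)) + ∫ u, h u * g (r * u + τ) := by
      have hσ' : Integrable fun u => h u * σ (r * u + τ) :=
        hbdd _ (hσm.comp (hlin τ)) fun x => hσ1 _
      rw [← integral_add hσ' hg']
      refine integral_congr_ae (ae_of_all _ fun u => ?_)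
      simp only [hσ]
      ring
    rw [hχσ, hsplit, integral_mul_comp_eq_neg hhi hh hf hfh hγc hgd]
    have hpos : 0 < m * (r * (1 + R) ^ (-(5 / 4) : ℝ)) := by positivity
    have := (abs_le.1 hplus).2
    have := (abs_le.1 hminus).2
    have := (abs_le.1 hmid).2
    linarith
  have htr : t / r < t' / r := by gcongr
  obtain ⟨hint, heq⟩ := integral_mul_comp_sub_eq hfi hhm hhi hfh hχm hχ1 r (t / r) (t' / r) htr.le
  have hscale : ∀ y u : ℝ, r * (u + y) = r * u + r * y := fun y u => by ring
  have hpos : 0 < ∫ y in (t / r)..(t' / r), -∫ u, h u * χ (r * (u + y)) :=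
    intervalIntegral.intervalIntegral_pos_of_pos hint.neg
      (fun y => by simp only [hscale]; exact neg_pos.2 (hneg _)) htr
  rw [intervalIntegral.integral_neg, ← heq] at hpos
  simp only [hscale, mul_div_cancel₀ _ hr0.ne'] at hpos
  exact sub_pos.1 hpos

/-! ### Section functions of convex bodies. -/

/-- The measure of the section of `K` over the point `u` of the first factor. -/
noncomputable def sectionMeasure {W : Type*} [MeasurableSpace W] (ν : Measure W)
    (K : Set (ℝ × W)) (u : ℝ) : ℝ :=
  ν.real (Prod.mk u ⁻¹' K)

theorem sectionMeasure_nonneg {W : Type*} [MeasurableSpace W] {ν : Measure W} (K : Set (ℝ × W))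
    (u : ℝ) : 0 ≤ sectionMeasure ν K u :=
  measureReal_nonneg

theorem isCompact_section {W : Type*} [TopologicalSpace W] {K : Set (ℝ × W)} (hK : IsCompact K)
    (u : ℝ) : IsCompact (Prod.mk u ⁻¹' K) :=
  (Topology.IsClosedEmbedding.of_continuous_injective_isClosedMap (by fun_prop)
    (Prod.mk_right_injective u) (isClosedMap_prodMk_left u)).isCompact_preimage hK

section Sections

variable {W : Type*} [NormedAddCommGroup W] [NormedSpace ℝ W] [FiniteDimensional ℝ W]
  [MeasurableSpace W] [BorelSpace W] {ν : Measure W} [ν.IsAddHaarMeasure]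

/-- By convexity, the homothety of ratio `ρ` centred at a point of `K` maps one section into the
other. -/
theorem pow_mul_sectionMeasure_le {K : Set (ℝ × W)} (hK : IsCompact K) (hc : Convex ℝ K)
    {e : ℝ} {we : W} (he : (e, we) ∈ K) {ρ : ℝ} (h0 : 0 ≤ ρ) (h1 : ρ ≤ 1) (u : ℝ) :
    ρ ^ Module.finrank ℝ W * sectionMeasure ν K u ≤ sectionMeasure ν K (ρ * u + (1 - ρ) * e) := by
  have hsub : AffineMap.homothety we ρ '' (Prod.mk u ⁻¹' K) ⊆
      Prod.mk (ρ * u + (1 - ρ) * e) ⁻¹' K := by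
    rintro _ ⟨w, hw, rfl⟩
    have := hc hw he h0 (sub_nonneg.2 h1) (by ring)
    simp only [Prod.smul_mk, Prod.mk_add_mk, smul_eq_mul] at this
    rw [Set.mem_preimage, AffineMap.homothety_apply]
    convert this using 2
    simp only [vsub_eq_sub, vadd_eq_add, smul_sub, sub_smul, one_smul]
    abel
  have hle := measure_mono (μ := ν) hsub
  rw [Measure.addHaar_image_homothety, abs_of_nonneg (pow_nonneg h0 _)] at hle
  have := ENNReal.toReal_mono (isCompact_section hK _).measure_lt_top.ne hle
  rwa [ENNReal.toReal_mul, ENNReal.toReal_ofReal (pow_nonneg h0 _)] at this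

theorem sectionMeasure_sub_le {K : Set (ℝ × W)} (hK : IsCompact K) (hc : Convex ℝ K)
    {e : ℝ} {we : W} (he : (e, we) ∈ K) {ρ : ℝ} (h0 : 0 ≤ ρ) (h1 : ρ ≤ 1) (u : ℝ) :
    sectionMeasure ν K u - sectionMeasure ν K (ρ * u + (1 - ρ) * e) ≤
      Module.finrank ℝ W * (1 - ρ) * sectionMeasure ν K u := by
  have h2 := pow_mul_sectionMeasure_le (ν := ν) hK hc he h0 h1 u
  have h3 := one_add_mul_le_pow (show -2 ≤ ρ - 1 by linarith) (Module.finrank ℝ W)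
  rw [add_sub_cancel] at h3
  have h4 := mul_le_mul_of_nonneg_right h3 (sectionMeasure_nonneg (ν := ν) K u)
  linarith

/-- The section lies in a ball of radius `√(C s)` in dimension `k ≥ 1`; one factor gives `√s`, and
`s ≤ 2` bounds the others. In dimension `0` there would be no decay. -/
theorem sectionMeasure_le_of_norm_sub_sq_le [Nontrivial W] {C : ℝ} (hC : 0 ≤ C) :
    ∃ D : ℝ, 0 < D ∧ ∀ (K : Set (ℝ × W)) (u s : ℝ) (w₀ : W), 0 ≤ s → s ≤ 2 →
      (∀ w, (u, w) ∈ K → ‖w - w₀‖ ^ 2 ≤ C * s) → sectionMeasure ν K u ≤ D * √s := by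
  set k := Module.finrank ℝ W with hk
  have hk1 : 0 < k := Module.finrank_pos
  refine ⟨√C * √(C * 2) ^ (k - 1) * ν.real (Metric.ball 0 1) + 1, by positivity,
    fun K u s w₀ hs0 hs2 hw => ?_⟩
  have hsub : Prod.mk u ⁻¹' K ⊆ Metric.closedBall w₀ √(C * s) := fun w hwK => by
    rw [mem_closedBall_iff_norm]
    exact Real.le_sqrt_of_sq_le (hw w hwK)
  have hle := measureReal_mono (μ := ν) hsub (isCompact_closedBall _ _).measure_lt_top.ne
  have hball : ν.real (Metric.closedBall w₀ √(C * s)) = √(C * s) ^ k * ν.real (Metric.ball 0 1) := by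
    rw [measureReal_def, Measure.addHaar_closedBall _ _ (Real.sqrt_nonneg _), ENNReal.toReal_mul,
      ENNReal.toReal_ofReal (by positivity), measureReal_def]
  calc sectionMeasure ν K u ≤ √(C * s) ^ k * ν.real (Metric.ball 0 1) := hball ▸ hle
    _ = √(C * s) * √(C * s) ^ (k - 1) * ν.real (Metric.ball 0 1) := by
        rw [← pow_succ', Nat.sub_add_cancel hk1]
    _ ≤ √C * √s * √(C * 2) ^ (k - 1) * ν.real (Metric.ball 0 1) := by
        rw [Real.sqrt_mul hC s]
        gcongr
        rw [← Real.sqrt_mul hC s]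
        gcongr
    _ = (√C * √(C * 2) ^ (k - 1) * ν.real (Metric.ball 0 1)) * √s := by ring
    _ ≤ _ := by
        gcongr
        linarith

open Set in
/-- Slices of a convex body that is pinched quadratically at both ends: they can be detected by a
measurable set on the line. -/
theorem exists_measurableSet_strictMono_sectionMeasure [Nontrivial W] {K : Set (ℝ × W)}
    (hK : IsCompact K) (hc : Convex ℝ K) {C : ℝ} (hC : 0 ≤ C) {wp wq : W}
    (hp : ((1 : ℝ), wp) ∈ K) (hq : ((-1 : ℝ), wq) ∈ K) (hKs : ∀ z ∈ K, z.1 ∈ Icc (-1 : ℝ) 1)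
    (hKp : ∀ z ∈ K, ‖z.2 - wp‖ ^ 2 ≤ C * (1 - z.1)) (hKq : ∀ z ∈ K, ‖z.2 - wq‖ ^ 2 ≤ C * (1 + z.1))
    (hpos : ((volume : Measure ℝ).prod ν) K ≠ 0) :
    ∃ S : Set ℝ, MeasurableSet S ∧ ∀ r : ℝ, 1 ≤ r → StrictMono fun t =>
      ∫ u, sectionMeasure ν K u * S.indicator (fun _ => (1 : ℝ)) (r * u + t) := by
  obtain ⟨D, hD0, hD⟩ := sectionMeasure_le_of_norm_sub_sq_le (ν := ν) hC
  set f := sectionMeasure ν K with hf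
  set k := Module.finrank ℝ W with hk
  have hf0 : ∀ u, 0 ≤ f u := sectionMeasure_nonneg K
  have hout : ∀ u, u ∉ Icc (-1 : ℝ) 1 → f u = 0 := by
    intro u hu
    have : Prod.mk u ⁻¹' K = ∅ := eq_empty_of_forall_notMem fun w hw => hu (hKs _ hw)
    rw [hf, sectionMeasure, this, measureReal_empty]
  have hDp : ∀ u ∈ Icc (-1 : ℝ) 1, f u ≤ D * √(1 - u) := fun u hu =>
    hD K u (1 - u) wp (by linarith [hu.2]) (by linarith [hu.1]) fun w hw => hKp _ hw
  have hDq : ∀ u ∈ Icc (-1 : ℝ) 1, f u ≤ D * √(1 + u) := fun u hu =>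
    hD K u (1 + u) wq (by linarith [hu.1]) (by linarith [hu.2]) fun w hw => hKq _ hw
  have hf1 : f 1 = 0 := le_antisymm (by simpa using hDp 1 (by norm_num)) (hf0 1)
  have hf1' : f (-1) = 0 := le_antisymm (by simpa using hDq (-1) (by norm_num)) (hf0 (-1))
  -- `1 - x / y` is at most `2 (√y - √x) / √y`, and the decay `F ≤ D √y` absorbs the singular
  -- denominator.
  have alg : ∀ {x y F : ℝ}, 0 ≤ x → x ≤ y → 0 < y → 0 ≤ F → F ≤ D * √y →
      k * (1 - x / y) * F ≤ 2 * k * D * (√y - √x) := by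
    intro x y F hx hxy hy hF hFD
    have hA : 0 < √y := Real.sqrt_pos.2 hy
    have hB : 0 ≤ √x := Real.sqrt_nonneg x
    have hBA : √x ≤ √y := Real.sqrt_le_sqrt hxy
    have e1 : 1 - x / y = (√y - √x) * (√y + √x) / √y ^ 2 := by
      rw [Real.sq_sqrt hy.le]
      have h1 := Real.mul_self_sqrt hx
      have h2 := Real.mul_self_sqrt hy.le
      field_simp
      linarith
    have e2 : (√y - √x) * (√y + √x) / √y ^ 2 ≤ 2 * (√y - √x) / √y := by
      rw [div_le_div_iff₀ (by positivity) hA]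
      have : 0 ≤ (√y - √x) * (√y - √x) * √y := by
        have := sub_nonneg.2 hBA
        positivity
      nlinarith
    calc k * (1 - x / y) * F ≤ k * (2 * (√y - √x) / √y) * (D * √y) := by
          have := sub_nonneg.2 hBA
          rw [e1]
          gcongr
      _ = 2 * k * D * (√y - √x) := by
          field_simp
  have hinner : ∀ u v, u ∈ Icc (-1 : ℝ) 1 → v ∈ Icc (-1 : ℝ) 1 → u ≤ v →
      |f v - f u| ≤ 2 * k * D * (edgeProfile v - edgeProfile u) := by
    intro u v hu hv huv
    have hM : 0 ≤ 2 * k * D := by positivity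
    have s1 : 0 ≤ √(1 + v) - √(1 + u) := sub_nonneg.2 (Real.sqrt_le_sqrt (by linarith))
    have s2 : 0 ≤ √(1 - u) - √(1 - v) := sub_nonneg.2 (Real.sqrt_le_sqrt (by linarith))
    have hE : edgeProfile v - edgeProfile u =
        (√(1 + v) - √(1 + u)) + (√(1 - u) - √(1 - v)) := by
      unfold edgeProfile
      ring
    rw [hE, mul_add]
    have p1 := mul_nonneg hM s1
    have p2 := mul_nonneg hM s2
    rw [abs_le]
    -- A decrease of `f` is controlled by a homothety towards the end `1`, an increase by one
    -- towards the end `-1`.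
    constructor
    · rcases eq_or_lt_of_le hu.2 with h1 | h1
      · have : v = u := le_antisymm (hv.2.trans h1.ge) huv
        rw [this]
        simp
      · have hy : 0 < 1 - u := by linarith
        have hρ0 : 0 ≤ (1 - v) / (1 - u) := div_nonneg (by linarith [hv.2]) hy.le
        have hρ1 : (1 - v) / (1 - u) ≤ 1 := (div_le_one hy).2 (by linarith)
        have h2 := sectionMeasure_sub_le (ν := ν) hK hc hp hρ0 hρ1 u
        rw [show (1 - v) / (1 - u) * u + (1 - (1 - v) / (1 - u)) * 1 = v by
          field_simp
          ring] at h2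
        have h3 := alg (x := 1 - v) (by linarith [hv.2]) (by linarith) hy (hf0 u) (hDp u hu)
        linarith
    · rcases eq_or_lt_of_le hv.1 with h1 | h1
      · have : u = v := le_antisymm huv (h1.symm.le.trans hu.1)
        rw [this]
        simp
      · have hy : 0 < 1 + v := by linarith
        have hρ0 : 0 ≤ (1 + u) / (1 + v) := div_nonneg (by linarith [hu.1]) hy.le
        have hρ1 : (1 + u) / (1 + v) ≤ 1 := (div_le_one hy).2 (by linarith)
        have h2 := sectionMeasure_sub_le (ν := ν) hK hc hq hρ0 hρ1 v
        rw [show (1 + u) / (1 + v) * v + (1 - (1 + u) / (1 + v)) * (-1) = u by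
          field_simp
          ring] at h2
        have h3 := alg (x := 1 + u) (by linarith [hu.1]) (by linarith) hy (hf0 v) (hDq v hv)
        linarith
  have hall : ∀ u v, u ≤ v → |f v - f u| ≤ 2 * k * D * (edgeProfile v - edgeProfile u) := by
    intro u v huv
    have hM : 0 ≤ 2 * k * D := by positivity
    have hnn := mul_nonneg hM (sub_nonneg.2 (edgeProfile_monotone huv))
    have hle : ∀ x, x ≤ -1 → f x = 0 := fun x hx => by
      rcases eq_or_lt_of_le hx with h | h
      · rw [h, hf1']
      · exact hout x fun h' => by linarith [h'.1]
    have hge : ∀ x, 1 ≤ x → f x = 0 := fun x hx => by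
      rcases eq_or_lt_of_le hx with h | h
      · rw [← h, hf1]
      · exact hout x fun h' => by linarith [h'.2]
    rcases le_total v (-1) with h1 | h1
    · rw [hle v h1, hle u (huv.trans h1)]
      simpa using hnn
    rcases le_total 1 u with h2 | h2
    · rw [hge u h2, hge v (h2.trans huv)]
      simpa using hnn
    have hu' : f u = f (max u (-1)) := by
      rcases le_total u (-1) with h | h
      · rw [max_eq_right h, hle u h, hf1']
      · rw [max_eq_left h]
    have hv' : f v = f (min v 1) := by
      rcases le_total v 1 with h | h
      · rw [min_eq_left h]
      · rw [min_eq_right h, hge v h, hf1]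
    rw [hu', hv']
    refine (hinner _ _ ⟨le_max_right _ _, max_le h2 (by norm_num)⟩
      ⟨le_min h1 (by norm_num), min_le_right _ _⟩
      (max_le (le_min huv h2) (le_min h1 (by norm_num)))).trans ?_
    have := edgeProfile_monotone (min_le_left v 1)
    have := edgeProfile_monotone (le_max_left u (-1))
    gcongr
  obtain ⟨u₀, hu₀⟩ : ∃ u₀, 0 < f u₀ := by
    by_contra! hcon
    refine hpos ?_
    rw [Measure.measure_prod_null hK.isClosed.measurableSet]
    refine ae_of_all _ fun u => ?_
    have h1 : f u = 0 := le_antisymm (hcon u) (hf0 u)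
    rw [hf, sectionMeasure, measureReal_def, ENNReal.toReal_eq_zero_iff] at h1
    exact h1.resolve_right (isCompact_section hK u).measure_lt_top.ne
  have hu₀m : u₀ ∈ Icc (-1 : ℝ) 1 := by_contra fun h => hu₀.ne' (hout u₀ h)
  have hu₀1 : u₀ < 1 := lt_of_le_of_ne hu₀m.2 fun h => hu₀.ne' (h ▸ hf1)
  have hu₀2 : -1 < u₀ := lt_of_le_of_ne hu₀m.1 fun h => hu₀.ne' (h ▸ hf1')
  have hlow : ∀ u, |u| ≤ 1 / 2 → (1 / 4) ^ k * f u₀ ≤ f u := by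
    intro u hu
    obtain ⟨ha, hb⟩ := abs_le.1 hu
    rcases le_total u₀ u with h | h
    · have hy : 0 < 1 - u₀ := by linarith
      have hρ : 1 / 4 ≤ (1 - u) / (1 - u₀) := by
        rw [div_le_div_iff₀ (by norm_num) hy]
        linarith
      have h2 := pow_mul_sectionMeasure_le (ν := ν) hK hc hp (by linarith : 0 ≤ (1 - u) / (1 - u₀))
        ((div_le_one hy).2 (by linarith)) u₀
      rw [show (1 - u) / (1 - u₀) * u₀ + (1 - (1 - u) / (1 - u₀)) * 1 = u by
          field_simp
          ring] at h2
      refine le_trans ?_ h2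
      gcongr
    · have hy : 0 < 1 + u₀ := by linarith
      have hρ : 1 / 4 ≤ (1 + u) / (1 + u₀) := by
        rw [div_le_div_iff₀ (by norm_num) hy]
        linarith
      have h2 := pow_mul_sectionMeasure_le (ν := ν) hK hc hq (by linarith : 0 ≤ (1 + u) / (1 + u₀))
        ((div_le_one hy).2 (by linarith)) u₀
      rw [show (1 + u) / (1 + u₀) * u₀ + (1 - (1 + u) / (1 + u₀)) * (-1) = u by
          field_simp
          ring] at h2
      refine le_trans ?_ h2
      gcongr
  obtain ⟨h, hhm, hhi, hh, hfh, hhC⟩ := exists_integrable_deriv (by positivity) hall hout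
  have hk1 : (0 : ℝ) < k := Nat.cast_pos.2 Module.finrank_pos
  exact exists_measurableSet_strictMono (by positivity) (by positivity) hf0 hlow hout hhm hhi hh
    hfh hhC

end Sections

open scoped RealInnerProductSpace

/-! ### Pinched directions. -/

section Directions

variable {V : Type*} [NormedAddCommGroup V] [InnerProductSpace ℝ V]

/-- The slab between the two extreme hyperplanes of `K` orthogonal to `a` has width `2` in terms of
the functional `⟪a, ·⟫`, and `K` is pinched at least quadratically at both of them. -/
def IsPinched (K : Set V) (a : V) : Prop :=
  ∃ p ∈ K, ∃ q ∈ K, ∃ C : ℝ, 0 < C ∧ ⟪a, p⟫ - ⟪a, q⟫ = 2 ∧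
    ∀ x ∈ K, ‖x - p‖ ^ 2 ≤ C * (⟪a, p⟫ - ⟪a, x⟫) ∧ ‖x - q‖ ^ 2 ≤ C * (⟪a, x⟫ - ⟪a, q⟫)

/-- The extremal chords of a body with respect to an auxiliary Euclidean structure provide pinched
directions. -/
theorem exists_isPinched_inner_ne_zero {K : Set V} (hK : IsCompact K) (hi : (interior K).Nonempty)
    {v : V} (hv : v ≠ 0) : ∃ a, IsPinched K a ∧ ⟪a, v⟫ ≠ 0 := by
  obtain ⟨x₀, hx₀, y₀, hy₀, hxy⟩ : ∃ x₀ ∈ K, ∃ y₀ ∈ K, ⟪x₀ - y₀, v⟫ ≠ 0 := by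
    obtain ⟨z, hz⟩ := hi
    have hnear : ∀ᶠ s : ℝ in nhds 0, z + s • v ∈ interior K := by
      have hcont : ContinuousAt (fun s : ℝ => z + s • v) 0 := by fun_prop
      refine hcont.eventually_mem (isOpen_interior.mem_nhds ?_)
      simpa using hz
    obtain ⟨s, hs, hs0⟩ := ((hnear.filter_mono nhdsWithin_le_nhds).and
      (self_mem_nhdsWithin : {s : ℝ | s ≠ 0} ∈ nhdsWithin (0 : ℝ) {0}ᶜ)).exists
    refine ⟨z + s • v, interior_subset hs, z, interior_subset hz, ?_⟩
    rw [add_sub_cancel_left, real_inner_smul_left, real_inner_self_eq_norm_sq]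
    have := norm_ne_zero_iff.2 hv
    exact mul_ne_zero hs0 (pow_ne_zero 2 this)
  obtain ⟨D, hD⟩ := hK.isBounded.exists_norm_le
  have hD' : ∀ x ∈ K, ∀ y ∈ K, ‖x - y‖ ≤ 2 * D := fun x hx y hy => by
    linarith [norm_sub_le x y, hD x hx, hD y hy]
  set β := ⟪x₀ - y₀, v⟫ ^ 2 with hβ
  have hβ0 : 0 < β := by positivity
  -- So small that `ε ‖x - y‖ ^ 2 < β` on `K`: the maximal value of `Q` cannot come from the norm
  -- term alone, which forces `⟪w, v⟫ ≠ 0`.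
  set ε := β / ((2 * D) ^ 2 + 1) with hε
  have hε0 : 0 < ε := by positivity
  let Q : V → ℝ := fun x => ⟪x, v⟫ ^ 2 + ε * ‖x‖ ^ 2
  obtain ⟨⟨p, q⟩, ⟨hp, hq⟩, hmax⟩ := (hK.prod hK).exists_isMaxOn ⟨(x₀, y₀), hx₀, hy₀⟩
    (show Continuous fun z : V × V => Q (z.1 - z.2) by fun_prop).continuousOn
  have hmax' : ∀ x ∈ K, ∀ y ∈ K, Q (x - y) ≤ Q (p - q) := fun x hx y hy =>
    hmax (show (x, y) ∈ K ×ˢ K from ⟨hx, hy⟩)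
  set w := p - q with hw
  have hQw : β ≤ Q w := by
    refine le_trans ?_ (hmax' x₀ hx₀ y₀ hy₀)
    simp only [Q, ← hβ]
    have : 0 ≤ ε * ‖x₀ - y₀‖ ^ 2 := by positivity
    linarith
  have hQw0 : 0 < Q w := hβ0.trans_le hQw
  have hwv : ⟪w, v⟫ ≠ 0 := by
    intro h0
    have h1 : Q w = ε * ‖w‖ ^ 2 := by simp [Q, h0]
    have h2 : ‖w‖ ^ 2 ≤ (2 * D) ^ 2 := by
      have := hD' p hp q hq
      gcongr
    have h3 : ε * ((2 * D) ^ 2 + 1) = β := by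
      rw [hε]
      field_simp
    nlinarith
  -- Half the gradient of `Q` at `w`. Expanding `Q (x - q) ≤ Q w` and `Q (p - x) ≤ Q w` around `w`
  -- gives the two pinching inequalities.
  set b := ⟪w, v⟫ • v + ε • w with hb
  have hbx : ∀ x, ⟪b, x⟫ = ⟪w, v⟫ * ⟪x, v⟫ + ε * ⟪w, x⟫ := fun x => by
    rw [hb, inner_add_left, real_inner_smul_left, real_inner_smul_left, real_inner_comm v x]
  have hpar : ∀ x, Q (w + x) = Q w + 2 * ⟪b, x⟫ + Q x := fun x => by
    simp only [Q]
    rw [hbx, inner_add_left, norm_add_sq_real]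
    ring
  have hQneg : ∀ x, Q (-x) = Q x := fun x => by simp [Q]
  have hbw : ⟪b, w⟫ = Q w := by
    rw [hbx, real_inner_self_eq_norm_sq]
    simp only [Q]
    ring
  have hQn : ∀ x, ε * ‖x‖ ^ 2 ≤ Q x := fun x => by
    simp only [Q]
    linarith [sq_nonneg ⟪x, v⟫]
  have hcp : ∀ x ∈ K, ε * ‖x - p‖ ^ 2 ≤ 2 * (⟪b, p⟫ - ⟪b, x⟫) := fun x hx => by
    have h1 := hpar (x - p)
    rw [show w + (x - p) = x - q by rw [hw]; abel, inner_sub_right] at h1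
    linarith [hmax' x hx q hq, hQn (x - p)]
  have hcq : ∀ x ∈ K, ε * ‖x - q‖ ^ 2 ≤ 2 * (⟪b, x⟫ - ⟪b, q⟫) := fun x hx => by
    have h1 := hpar (-(x - q))
    rw [show w + -(x - q) = p - x by rw [hw]; abel, inner_neg_right, inner_sub_right, hQneg] at h1
    linarith [hmax' p hp x hx, hQn (x - q)]
  have hsc : ∀ x, ⟪(2 / Q w) • b, x⟫ = 2 / Q w * ⟪b, x⟫ := fun x => real_inner_smul_left _ _ _
  refine ⟨(2 / Q w) • b, ⟨p, hp, q, hq, Q w / ε, by positivity, ?_, fun x hx => ⟨?_, ?_⟩⟩, ?_⟩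
  · rw [hsc, hsc, ← mul_sub, ← inner_sub_right, hbw]
    field_simp
  · rw [hsc, hsc, ← mul_sub, ← mul_assoc, div_mul_div_comm, mul_comm (Q w), mul_div_mul_right _ _ hQw0.ne',
      div_mul_eq_mul_div, le_div_iff₀ hε0]
    linarith [hcp x hx]
  · rw [hsc, hsc, ← mul_sub, ← mul_assoc, div_mul_div_comm, mul_comm (Q w), mul_div_mul_right _ _ hQw0.ne',
      div_mul_eq_mul_div, le_div_iff₀ hε0]
    linarith [hcq x hx]
  · rw [hsc, hbx, real_inner_self_eq_norm_sq, show ⟪w, v⟫ * ‖v‖ ^ 2 + ε * ⟪w, v⟫ =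
      ⟪w, v⟫ * (‖v‖ ^ 2 + ε) by ring]
    exact mul_ne_zero (by positivity) (mul_ne_zero hwv (by positivity))

/-- No nonzero vector is orthogonal to all pinched directions, so they span and contain a basis. -/
theorem exists_basis_isPinched [FiniteDimensional ℝ V] {K : Set V} (hK : IsCompact K)
    (hi : (interior K).Nonempty) {d : ℕ} (hd : Module.finrank ℝ V = d) :
    ∃ B : Module.Basis (Fin d) ℝ V, ∀ i, IsPinched K (B i) := by
  have hspan : Submodule.span ℝ {a | IsPinched K a} = ⊤ := by
    rw [← Submodule.orthogonal_eq_bot_iff, Submodule.eq_bot_iff]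
    intro v hv
    by_contra hv0
    obtain ⟨a, ha, hav⟩ := exists_isPinched_inner_ne_zero hK hi hv0
    exact hav ((Submodule.mem_orthogonal _ _).1 hv a (Submodule.subset_span ha))
  obtain ⟨b, hbs, hbspan, hbi⟩ := exists_linearIndependent ℝ {a : V | IsPinched K a}
  let B := Module.Basis.mk hbi (by rw [Subtype.range_coe, hbspan, hspan])
  let B' := Module.finBasisOfFinrankEq ℝ V hd
  refine ⟨B.reindex (B.indexEquiv B'), fun i => ?_⟩
  rw [Module.Basis.reindex_apply, Module.Basis.mk_apply]
  exact hbs (Subtype.coe_prop _)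

end Directions

/-! ### From the line to slabs in space. -/

section Slabs

variable {V : Type*} [NormedAddCommGroup V] [InnerProductSpace ℝ V] [FiniteDimensional ℝ V]
  [MeasurableSpace V] [BorelSpace V]

open Set in
/-- In a pinched direction, a union of slabs determines the position of a body of known size. -/
theorem exists_measurableSet_inner_eq (μ : Measure V) [μ.IsAddHaarMeasure]
    (hd : 2 ≤ Module.finrank ℝ V) {K : Set V} (hK : IsCompact K) (hc : Convex ℝ K)
    (hi : (interior K).Nonempty) {a : V} (ha : IsPinched K a) :
    ∃ S : Set ℝ, MeasurableSet S ∧ ∀ r : ℝ, 1 ≤ r → ∀ x y : V,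
      μ (K ∩ {z | ⟪a, r • z + x⟫ ∈ S}) = μ (K ∩ {z | ⟪a, r • z + y⟫ ∈ S}) → ⟪a, x⟫ = ⟪a, y⟫ := by
  obtain ⟨p, hp, q, hq, C, hC, hpq, hKC⟩ := ha
  have ha0 : a ≠ 0 := by
    rintro rfl
    simp at hpq
  set W := (ℝ ∙ a)ᗮ with hW
  have hWd : Module.finrank ℝ W + 1 = Module.finrank ℝ V := by
    have := Submodule.finrank_add_finrank_orthogonal (ℝ ∙ a)
    rw [finrank_span_singleton ha0, ← hW] at this
    omega
  have hWn : Nontrivial W := Module.nontrivial_of_finrank_pos (R := ℝ) (by omega)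
  let P : V →ₗ[ℝ] W := W.orthogonalProjectionOnto
  have hPn : ∀ x, ‖P x‖ ≤ ‖x‖ := fun x => W.norm_orthogonalProjectionOnto_apply_le x
  let L₀ : V →ₗ[ℝ] ℝ × W := (innerₛₗ ℝ a).prod P
  have hL₀ : Function.Injective L₀ := by
    rw [← LinearMap.ker_eq_bot, LinearMap.ker_eq_bot']
    intro x hx
    have h1 : ⟪a, x⟫ = 0 := congrArg Prod.fst hx
    have h2 : P x = 0 := congrArg Prod.snd hx
    have h3 : x ∈ W := Submodule.mem_orthogonal_singleton_iff_inner_right.2 h1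
    have h4 : W.orthogonalProjectionOnto x = (⟨x, h3⟩ : W) :=
      Submodule.orthogonalProjectionOnto_mem_subspace_eq_self (⟨x, h3⟩ : W)
    have h5 : (⟨x, h3⟩ : W) = 0 := h4 ▸ h2
    exact congrArg Subtype.val h5
  let L : V ≃L[ℝ] ℝ × W := (L₀.linearEquivOfInjective hL₀ (by
    rw [Module.finrank_prod, Module.finrank_self]
    omega)).toContinuousLinearEquiv
  have hL : ∀ x, L x = (⟪a, x⟫, P x) := fun x => rfl
  let ν : Measure W := Measure.addHaar
  -- The midpoint of `⟪a, q⟫` and `⟪a, p⟫`; after subtracting it the body has heights in `[-1, 1]`.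
  set m : ℝ := ⟪a, p⟫ - 1 with hm
  let Φ : V → ℝ × W := fun x => L x + (-m, 0)
  have hΦc : Continuous Φ := by fun_prop
  have hΦi : Function.Injective Φ := fun x y h => L.injective (add_right_cancel h)
  have hΦ1 : ∀ x, (Φ x).1 = ⟪a, x⟫ - m := fun x => by simp [Φ, hL, sub_eq_add_neg]
  have hΦ2 : ∀ x, (Φ x).2 = P x := fun x => by simp [Φ, hL]
  -- `Φ` need not preserve measure, but by uniqueness of Haar measure it rescales it by a constant,
  -- harmless when comparing masses.
  obtain ⟨c, hc0, hct, hmap⟩ : ∃ c : ENNReal, c ≠ 0 ∧ c ≠ ⊤ ∧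
      μ.map Φ = c • ((volume : Measure ℝ).prod ν) := by
    have hH : (μ.map L).IsAddHaarMeasure := L.isAddHaarMeasure_map μ
    refine ⟨Measure.addHaarScalarFactor (μ.map L) ((volume : Measure ℝ).prod ν), ?_,
      ENNReal.coe_ne_top, ?_⟩
    · simpa only [ne_eq, ENNReal.coe_eq_zero] using
        (Measure.addHaarScalarFactor_pos_of_isAddHaarMeasure (μ.map L)
          ((volume : Measure ℝ).prod ν)).ne'
    · have h1 : μ.map Φ = (μ.map L).map (· + (-m, (0 : W))) := by
        rw [Measure.map_map (by fun_prop) L.continuous.measurable]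
        rfl
      rw [h1, map_add_right_eq_self]
      exact Measure.isAddLeftInvariant_eq_smul _ _
  set K' := Φ '' K with hK'
  have hK'c : IsCompact K' := hK.image hΦc
  have hK'm : MeasurableSet K' := hK'c.isClosed.measurableSet
  have hpre : Φ ⁻¹' K' = K := hΦi.preimage_image K
  have hK'conv : Convex ℝ K' := by
    have h1 : K' = (fun z => (-m, (0 : W)) + z) '' (L '' K) := by
      rw [hK', image_image]
      simp only [Φ, add_comm]
    rw [h1]
    exact Convex.translate (hc.linear_image L.toLinearEquiv.toLinearMap) _
  have hK'pos : ((volume : Measure ℝ).prod ν) K' ≠ 0 := by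
    intro h0
    have h1 : μ.map Φ K' = 0 := by
      rw [hmap, Measure.smul_apply, h0, smul_zero]
    rw [Measure.map_apply hΦc.measurable hK'm, hpre] at h1
    exact (Measure.measure_pos_of_nonempty_interior μ hi).ne' h1
  have hPe : ∀ e : V, ((Φ e).1, P e) = Φ e := fun e => Prod.ext rfl (hΦ2 e).symm
  have hp1 : (Φ p).1 = 1 := by rw [hΦ1, hm]; ring
  have hq1 : (Φ q).1 = -1 := by rw [hΦ1, hm]; linarith
  have hnorm : ∀ x e, ‖(Φ x).2 - P e‖ ^ 2 ≤ ‖x - e‖ ^ 2 := fun x e => by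
    rw [hΦ2, ← map_sub]
    have := hPn (x - e)
    gcongr
  obtain ⟨S, hS, hmono⟩ := exists_measurableSet_strictMono_sectionMeasure (ν := ν) hK'c hK'conv
    hC.le (wp := P p) (wq := P q) (by rw [← hp1, hPe]; exact mem_image_of_mem _ hp)
    (by rw [← hq1, hPe]; exact mem_image_of_mem _ hq)
    (by
      rintro _ ⟨x, hx, rfl⟩
      obtain ⟨h1, h2⟩ := hKC x hx
      have h3 := nonneg_of_mul_nonneg_right ((sq_nonneg _).trans h1) hC
      have h4 := nonneg_of_mul_nonneg_right ((sq_nonneg _).trans h2) hC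
      rw [hΦ1, hm]
      constructor <;> linarith)
    (by
      rintro _ ⟨x, hx, rfl⟩
      refine (hnorm x p).trans ((hKC x hx).1.trans_eq ?_)
      rw [hΦ1, hm]
      ring)
    (by
      rintro _ ⟨x, hx, rfl⟩
      refine (hnorm x q).trans ((hKC x hx).2.trans_eq ?_)
      rw [hΦ1, hm, show ⟪a, q⟫ = ⟪a, p⟫ - 2 by linarith]
      ring)
    hK'pos
  have hfi : Integrable (sectionMeasure ν K') :=
    Measure.integrable_measure_prodMk_left hK'm hK'c.measure_lt_top.ne
  have hform : ∀ (r : ℝ) (x : V), μ (K ∩ {z | ⟪a, r • z + x⟫ ∈ S}) = c * ENNReal.ofReal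
      (∫ u, sectionMeasure ν K' u * S.indicator (fun _ => (1 : ℝ)) (r * u + (r * m + ⟪a, x⟫))) := by
    intro r x
    set t := r * m + ⟪a, x⟫ with ht
    have hlin : Measurable fun u : ℝ => r * u + t := by fun_prop
    have hAm : MeasurableSet (K' ∩ {z | r * z.1 + t ∈ S}) :=
      hK'm.inter ((hlin.comp measurable_fst) hS)
    have h1 : K ∩ {z | ⟪a, r • z + x⟫ ∈ S} = Φ ⁻¹' (K' ∩ {z | r * z.1 + t ∈ S}) := by
      rw [preimage_inter, hpre]
      congr 1
      ext z
      simp only [mem_ofPred_eq, mem_preimage]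
      rw [hΦ1, inner_add_right, real_inner_smul_right, ht]
      congr! 1
      ring
    rw [h1, ← Measure.map_apply hΦc.measurable hAm, hmap, Measure.smul_apply, smul_eq_mul,
      Measure.prod_apply hAm]
    congr 1
    have hint : Integrable fun u =>
        sectionMeasure ν K' u * S.indicator (fun _ => (1 : ℝ)) (r * u + t) := by
      refine hfi.mul_bdd (c := 1)
        ((measurable_const.indicator hS).comp hlin).aestronglyMeasurable (ae_of_all _ fun u => ?_)
      by_cases hu : r * u + t ∈ S <;> simp [hu]
    rw [ofReal_integral_eq_lintegral_ofReal hint (ae_of_all _ fun u =>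
      mul_nonneg (sectionMeasure_nonneg _ _) (indicator_nonneg (fun _ _ => zero_le_one) _))]
    refine lintegral_congr fun u => ?_
    by_cases hu : r * u + t ∈ S
    · have h2 : Prod.mk u ⁻¹' (K' ∩ {z | r * z.1 + t ∈ S}) = Prod.mk u ⁻¹' K' := by
        ext w
        simp [hu]
      rw [h2, indicator_of_mem hu, mul_one, sectionMeasure, measureReal_def,
        ENNReal.ofReal_toReal (isCompact_section hK'c u).measure_lt_top.ne]
    · have h2 : Prod.mk u ⁻¹' (K' ∩ {z | r * z.1 + t ∈ S}) = ∅ := by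
        ext w
        simp [hu]
      rw [h2, indicator_of_notMem hu, mul_zero, ENNReal.ofReal_zero, measure_empty]
  refine ⟨S, hS, fun r hr x y hxy => ?_⟩
  rw [hform, hform] at hxy
  have hnn : ∀ t, 0 ≤ ∫ u, sectionMeasure ν K' u * S.indicator (fun _ => (1 : ℝ)) (r * u + t) :=
    fun t => integral_nonneg fun u =>
      mul_nonneg (sectionMeasure_nonneg _ _) (indicator_nonneg (fun _ _ => zero_le_one) _)
  have h1 := (ENNReal.mul_right_inj hc0 hct).1 hxy
  have h2 := (ENNReal.ofReal_eq_ofReal_iff (hnn _) (hnn _)).1 h1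
  have h3 := (hmono r hr).injective h2
  exact add_left_cancel h3

end Slabs

/-! ### Magnified copies and the reconstruction. -/

open scoped Pointwise in
theorem volume_magnifiedCopy {d : ℕ} (E : Set (EuclideanSpace ℝ (Fin d))) {r : ℝ} (hr : 0 ≤ r)
    (x : EuclideanSpace ℝ (Fin d)) :
    volume (magnifiedCopy E r x) = ENNReal.ofReal (r ^ d) * volume E := by
  have h1 : magnifiedCopy E r x = (fun y => y + x) '' (r • E) := by
    rw [magnifiedCopy, ← Set.image_smul, Set.image_image]
  rw [h1, Set.image_add_right, measure_preimage_add_right, Measure.addHaar_smul,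
    finrank_euclideanSpace_fin, abs_of_nonneg (pow_nonneg hr d)]

theorem magnifiedCopy_inter {d : ℕ} (E T : Set (EuclideanSpace ℝ (Fin d))) (r : ℝ)
    (x : EuclideanSpace ℝ (Fin d)) :
    magnifiedCopy E r x ∩ T = magnifiedCopy (E ∩ {y | r • y + x ∈ T}) r x := by
  ext z
  constructor
  · rintro ⟨⟨y, hy, rfl⟩, hz⟩
    exact ⟨y, ⟨hy, hz⟩, rfl⟩
  · rintro ⟨y, ⟨hy, hz⟩, rfl⟩
    exact ⟨⟨y, hy, rfl⟩, hz⟩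

open scoped Pointwise in
theorem Convex.magnifiedCopy {d : ℕ} {E : Set (EuclideanSpace ℝ (Fin d))} (hE : Convex ℝ E) (r : ℝ)
    (x : EuclideanSpace ℝ (Fin d)) : Convex ℝ (magnifiedCopy E r x) := by
  have h1 : _root_.magnifiedCopy E r x = (fun y => x + y) '' (r • E) := by
    rw [_root_.magnifiedCopy, ← Set.image_smul, Set.image_image]
    simp only [add_comm]
  rw [h1]
  exact Convex.translate (hE.smul r) x

theorem corollaryc (d : ℕ) (hd : 2 ≤ d) (E : Set (EuclideanSpace ℝ (Fin d)))
    (hbdd : Bornology.IsBounded E) (hconv : Convex ℝ E) (hint : (interior E).Nonempty) :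
    CanBeReconstructed (magnifiedCopies E) (d + 1) := by
  have hEtop : volume E < ⊤ := hbdd.measure_lt_top
  have hEpos : volume E ≠ 0 := (Measure.measure_pos_of_nonempty_interior _ hint).ne'
  refine ⟨?_, ?_⟩
  · rintro _ ⟨r, x, hr, rfl⟩
    refine ⟨(hconv.magnifiedCopy r x).nullMeasurableSet volume, ?_⟩
    rw [volume_magnifiedCopy E (by linarith)]
    exact ENNReal.mul_lt_top ENNReal.ofReal_lt_top hEtop
  have hfr : Module.finrank ℝ (EuclideanSpace ℝ (Fin d)) = d := finrank_euclideanSpace_fin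
  have hK : IsCompact (closure E) := hbdd.isCompact_closure
  have hKi : (interior (closure E)).Nonempty := hint.mono (interior_mono subset_closure)
  -- Longest chords require compactness, so the slabs are built for `closure E`; the frontier of a
  -- convex set is null.
  have hcl : ∀ A, volume (closure E ∩ A) = volume (E ∩ A) := fun A => measure_congr
    ((closure_ae_eq_of_null_frontier (hconv.addHaar_frontier volume)).inter (ae_eq_refl A))
  obtain ⟨B, hB⟩ := exists_basis_isPinched hK hKi hfr
  choose S hS hSinj using fun i => exists_measurableSet_inner_eq volume (hfr.symm ▸ hd) hK
    hconv.closure hKi (hB i)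
  refine ⟨Fin.cons Set.univ fun i => {z | ⟪B i, z⟫ ∈ S i}, fun i => ?_, ?_⟩
  · refine Fin.cases MeasurableSet.univ (fun i => ?_) i
    rw [Fin.cons_succ]
    exact (continuous_const.inner continuous_id).measurable (hS i)
  rintro _ ⟨r, x, hr, rfl⟩ _ ⟨s, y, hs, rfl⟩ h
  have hr0 : 0 ≤ r := by linarith
  have hs0 : 0 ≤ s := by linarith
  obtain rfl : r = s := by
    have h0 := h 0
    rw [Fin.cons_zero, Set.inter_univ, Set.inter_univ, volume_magnifiedCopy E hr0,
      volume_magnifiedCopy E hs0, ENNReal.mul_left_inj hEpos hEtop.ne,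
      ENNReal.ofReal_eq_ofReal_iff (by positivity) (by positivity)] at h0
    exact (pow_left_inj₀ hr0 hs0 (by omega)).1 h0
  have hxy : x = y := by
    refine InnerProductSpace.ext_inner_left_basis B fun i => hSinj i r hr x y ?_
    have hi := h i.succ
    rw [Fin.cons_succ, magnifiedCopy_inter, magnifiedCopy_inter, volume_magnifiedCopy _ hr0,
      volume_magnifiedCopy _ hr0, ENNReal.mul_right_inj
        (by simpa using pow_pos (show 0 < r by linarith) d) ENNReal.ofReal_ne_top] at hi
    rw [hcl, hcl]
    exact hi
  rw [hxy]
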